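/- Let $\mathscr T=((T^+,\Delta^+),(T,\Delta))$ be a concrete regularity structure. That is: $T^+=\bigoplus_{\alpha\in A^+}T^+_\alpha$ and $T=\bigoplus_{\beta\in A}T_\beta$ are real vector spaces graded by sets $A^+\subset[0,\infty)$ and $A\subset\mathbb R$ without accumulation points in $\mathbb R$, with $0\in A^+$, $A^++A^+\subset A^+$, $A$ bounded below, and finite dimensional homogeneous components; $T^+$ is a Hopf algebra with unit $\mathbf 1$, coproduct $\Delta^+$, $T^+_0=\langle\mathbf 1\rangle$, $T^+_\alpha T^+_\beta\subset T^+_{\alpha+\beta}$, and $$\Delta^+\tau\in\tau\otimes\mathbf 1+\mathbf 1\otimes\tau+\sum_{0<\beta<\alpha}T^+_\beta\otimes T^+_{\alpha-\beta}\qquad(\tau\in T^+_\alpha,\ \alpha>0);$$ the linear map $\Delta:T\to T\otimes T^+$ satisfies $\Delta\tau\in\tau\otimes\mathbf 1+\sum_{\beta<\alpha}T_\beta\otimes T^+_{\alpha-\beta}$ for $\tau\in T_\alpha$, and $(\Delta\otimes\mathrm{Id})\Delta=(\mathrm{Id}\otimes\Delta^+)\Delta$. Let $\mathcal B^+\ni\mathbf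 1$ and $\mathcal B$ be bases of $T^+$ and $T$ made of homogeneous elements, and let $|\tau|$ be the degree of a basis element $\tau$. For $\tau\in\mathcal B$ write $\Delta\tau=\sum_{\sigma\in\mathcal B}\sigma\otimes(\tau/\sigma)$ with $\tau/\sigma\in T^+$, and write $\sigma<\tau$ if $\tau/\sigma\neq0$ and $\sigma\neq\tau$. For $\tau\in\mathcal B^+$ write $\Delta^+\tau=\sum_{\sigma\in\mathcal B^+}\sigma\otimes(\tau/^+\sigma)$, and define $\sigma<^+\tau$ in the same way. Let $\mathsf g:\mathbb R^d\to G^+$, $x\mapsto\mathsf g_x$, take values in the group of unital real characters of $T^+$ (with convolution as product). Set $\mathsf g_{yx}:=\mathsf g_y*\mathsf g_x^{-1}$, and assume that for every $\tau\in\mathcal B^+$ $$\sup_{x}|\mathsf g_x(\tau)|+\sup_{x\ne y}\frac{|\mathsf g_{yx}(\tau)|}{|y-x|^{|\tau|}}<\infty .$$ This holds for instance if $(\mathsf g,\mathsf\Pi)$ is a model on $\mathscr T$. For $\tau\in T^+$ let $\mathsf g(\tau)$ be the bounded function $x\mapsto\mathsf g_x(\tau)$, viewed as a tempered distribution. Let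 $\Delta_i$ $(i\ge-1)$ be the Littlewood--Paley blocks of a dyadic partition of unity $(\rho_i)_{i\ge-1}$ with smooth radial $\rho_i:\mathbb R^d\to[0,1]$, $\operatorname{supp}\rho_{-1}\subset\{|x|<\frac43\}$, $\operatorname{supp}\rho_0\subset\{\frac34<|x|<\frac83\}$, $\rho_i=\rho_0(2^{-i}\cdot)$ for $i\ge0$, and let $\mathsf P_fh:=\sum_{j\ge1}\big(\sum_{-1\le i\le j-2}\Delta_if\big)\Delta_jh$ be the paraproduct, as a series in $\mathcal S'(\mathbb R^d)$. Define $\langle\!\langle\tau\rangle\!\rangle^{\mathsf g}$ for $\tau\in\mathcal B^+$ by recursion on $|\tau|$ through $$\mathsf g(\tau)=\sum_{\nu\in\mathcal B^+,\ \mathbf 1<^+\nu<^+\tau}\mathsf P_{\mathsf g(\tau/^+\nu)}\langle\!\langle\nu\rangle\!\rangle^{\mathsf g}+\langle\!\langle\tau\rangle\!\rangle^{\mathsf g},$$ and extend $\langle\!\langle\cdot\rangle\!\rangle^{\mathsf g}$ linearly to $T^+$. Then all the paraproduct series in this recursion converge in $\mathcal S'(\mathbb R^d)$, and for all $\sigma,\tau\in\mathcal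 B$ with $\sigma<\tau$ one has $$\mathsf g(\tau/\sigma)=\sum_{\eta\in\mathcal B,\ \sigma<\eta<\tau}\mathsf P_{\mathsf g(\tau/\eta)}\langle\!\langle\eta/\sigma\rangle\!\rangle^{\mathsf g}+\langle\!\langle\tau/\sigma\rangle\!\rangle^{\mathsf g},$$ where again all the paraproduct series converge in $\mathcal S'(\mathbb R^d)$. -/

import Mathlib

open scoped TensorProduct SchwartzMap FourierTransform ContDiff
open MeasureTheory

noncomputable section

/-! ### Concrete regularity structures -/

/-- The subspace `V ⊗ W` of `M ⊗ N`, for subspaces `V` of `M` and `W` of `N`. -/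
def tensorSubmodule {M N : Type*} [AddCommGroup M] [Module ℝ M] [AddCommGroup N] [Module ℝ N]
    (V : Submodule ℝ M) (W : Submodule ℝ N) : Submodule ℝ (M ⊗[ℝ] N) :=
  LinearMap.range (TensorProduct.map V.subtype W.subtype)

/-- A concrete regularity structure `((T⁺, Δ⁺), (T, Δ))`. The algebra `T⁺`, its coproduct `Δ⁺`
(`Coalgebra.comul`), counit and antipode are given by `[Ring Tp] [HopfAlgebra ℝ Tp]`. Both gradings
are written as families of subspaces indexed by `ℝ` which vanish outside the index sets. -/
structure ConcreteRegularityStructure (Tp T : Type*) [Ring Tp] [HopfAlgebra ℝ Tp]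
    [AddCommGroup T] [Module ℝ T] where
  /-- the index set `A⁺` of `T⁺` -/
  Ap : Set ℝ
  /-- the index set `A` of `T` -/
  A : Set ℝ
  /-- the homogeneous subspaces `T⁺_α` -/
  gradeP : ℝ → Submodule ℝ Tp
  /-- the homogeneous subspaces `T_β` -/
  grade : ℝ → Submodule ℝ T
  /-- the splitting map `Δ : T → T ⊗ T⁺` -/
  split : T →ₗ[ℝ] T ⊗[ℝ] Tp
  zero_mem_Ap : (0 : ℝ) ∈ Ap
  Ap_nonneg : ∀ α ∈ Ap, 0 ≤ α
  Ap_add : ∀ α ∈ Ap, ∀ β ∈ Ap, α + β ∈ Ap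
  A_bddBelow : BddBelow A
  Ap_discrete : ∀ x : ℝ, ¬ AccPt x (Filter.principal Ap)
  A_discrete : ∀ x : ℝ, ¬ AccPt x (Filter.principal A)
  gradeP_internal : DirectSum.IsInternal gradeP
  grade_internal : DirectSum.IsInternal grade
  gradeP_eq_bot : ∀ α, α ∉ Ap → gradeP α = ⊥
  grade_eq_bot : ∀ β, β ∉ A → grade β = ⊥
  gradeP_finite : ∀ α, FiniteDimensional ℝ (gradeP α)
  grade_finite : ∀ β, FiniteDimensional ℝ (grade β)
  gradeP_zero : gradeP 0 = Submodule.span ℝ {(1 : Tp)}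
  mul_mem_gradeP : ∀ α β : ℝ, ∀ a ∈ gradeP α, ∀ b ∈ gradeP β, a * b ∈ gradeP (α + β)
  comul_mem : ∀ α : ℝ, 0 < α → ∀ t ∈ gradeP α,
    Coalgebra.comul (R := ℝ) t - t ⊗ₜ[ℝ] (1 : Tp) - (1 : Tp) ⊗ₜ[ℝ] t ∈
      ⨆ β ∈ Set.Ioo 0 α, tensorSubmodule (gradeP β) (gradeP (α - β))
  split_mem : ∀ α : ℝ, ∀ t ∈ grade α,
    split t - t ⊗ₜ[ℝ] (1 : Tp) ∈
      ⨆ β ∈ Set.Iio α, tensorSubmodule (grade β) (gradeP (α - β))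
  /-- the right comodule property `(Δ ⊗ Id) Δ = (Id ⊗ Δ⁺) Δ` -/
  split_comodule :
    (TensorProduct.assoc ℝ T Tp Tp).toLinearMap ∘ₗ split.rTensor Tp ∘ₗ split =
      (Coalgebra.comul (R := ℝ) (A := Tp)).lTensor T ∘ₗ split

/-- Homogeneous bases `𝓑⁺` of `T⁺` and `𝓑` of `T`, indexed by `ιp` and `ι`. The elements of
homogeneity `α` form a basis of the homogeneous subspace of degree `α`, and `𝓑⁺` contains the
unit, so that `𝓑⁺_0 = {1}`. -/
structure HomogeneousBases {Tp T : Type*} [Ring Tp] [HopfAlgebra ℝ Tp]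
    [AddCommGroup T] [Module ℝ T] (S : ConcreteRegularityStructure Tp T) (ιp ι : Type*) where
  basisP : Module.Basis ιp ℝ Tp
  basis : Module.Basis ι ℝ T
  /-- homogeneity of the elements of `𝓑⁺` -/
  degP : ιp → ℝ
  /-- homogeneity of the elements of `𝓑` -/
  deg : ι → ℝ
  basisP_mem : ∀ i, basisP i ∈ S.gradeP (degP i)
  basis_mem : ∀ i, basis i ∈ S.grade (deg i)
  /-- the label of the unit -/
  one : ιp
  basisP_one : basisP one = 1

namespace HomogeneousBases

open Classical in
/-- `τ ↦ (σ ↦ τ /⁺ σ)` on `𝓑⁺`, determined by `Δ⁺ τ = ∑ σ ⊗ (τ /⁺ σ)`. -/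
def quotP {Tp T : Type*} [Ring Tp] [HopfAlgebra ℝ Tp] [AddCommGroup T] [Module ℝ T]
    {S : ConcreteRegularityStructure Tp T} {ιp ι : Type*} (B : HomogeneousBases S ιp ι)
    (τ : ιp) : ιp →₀ Tp :=
  TensorProduct.equivFinsuppOfBasisLeft B.basisP (Coalgebra.comul (R := ℝ) (B.basisP τ))

open Classical in
/-- `τ ↦ (σ ↦ τ / σ)` on `𝓑`, determined by `Δ τ = ∑ σ ⊗ (τ / σ)`. -/
def quot {Tp T : Type*} [Ring Tp] [HopfAlgebra ℝ Tp] [AddCommGroup T] [Module ℝ T]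
    {S : ConcreteRegularityStructure Tp T} {ιp ι : Type*} (B : HomogeneousBases S ιp ι)
    (τ : ι) : ι →₀ Tp :=
  TensorProduct.equivFinsuppOfBasisLeft B.basis (S.split (B.basis τ))

/-- `σ <⁺ τ` in `𝓑⁺`: `σ` is different from `τ` and appears on the left in `Δ⁺ τ`. -/
def ltP {Tp T : Type*} [Ring Tp] [HopfAlgebra ℝ Tp] [AddCommGroup T] [Module ℝ T]
    {S : ConcreteRegularityStructure Tp T} {ιp ι : Type*} (B : HomogeneousBases S ιp ι)
    (σ τ : ιp) : Prop :=
  B.quotP τ σ ≠ 0 ∧ σ ≠ τ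

/-- `σ < τ` in `𝓑`: `σ` is different from `τ` and appears on the left in `Δ τ`. -/
def lt {Tp T : Type*} [Ring Tp] [HopfAlgebra ℝ Tp] [AddCommGroup T] [Module ℝ T]
    {S : ConcreteRegularityStructure Tp T} {ιp ι : Type*} (B : HomogeneousBases S ιp ι)
    (σ τ : ι) : Prop :=
  B.quot τ σ ≠ 0 ∧ σ ≠ τ

open Classical in
/-- The finite set of all `ν ∈ 𝓑⁺` with `σ <⁺ ν <⁺ τ`. -/
def betweenP {Tp T : Type*} [Ring Tp] [HopfAlgebra ℝ Tp] [AddCommGroup T] [Module ℝ T]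
    {S : ConcreteRegularityStructure Tp T} {ιp ι : Type*} (B : HomogeneousBases S ιp ι)
    (σ τ : ιp) : Finset ιp :=
  (B.quotP τ).support.filter (fun ν => B.ltP σ ν ∧ B.ltP ν τ)

open Classical in
/-- The finite set of all `η ∈ 𝓑` with `σ < η < τ`. -/
def between {Tp T : Type*} [Ring Tp] [HopfAlgebra ℝ Tp] [AddCommGroup T] [Module ℝ T]
    {S : ConcreteRegularityStructure Tp T} {ιp ι : Type*} (B : HomogeneousBases S ιp ι)
    (σ τ : ι) : Finset ι :=
  (B.quot τ).support.filter (fun η => B.lt σ η ∧ B.lt η τ)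

theorem mem_betweenP {Tp T : Type*} [Ring Tp] [HopfAlgebra ℝ Tp] [AddCommGroup T] [Module ℝ T]
    {S : ConcreteRegularityStructure Tp T} {ιp ι : Type*} (B : HomogeneousBases S ιp ι)
    (σ τ ν : ιp) : ν ∈ B.betweenP σ τ ↔ B.ltP σ ν ∧ B.ltP ν τ := by
  classical
  simp only [betweenP, Finset.mem_filter, Finsupp.mem_support_iff]
  exact ⟨fun h => h.2, fun h => ⟨h.2.1, h⟩⟩

theorem mem_between {Tp T : Type*} [Ring Tp] [HopfAlgebra ℝ Tp] [AddCommGroup T] [Module ℝ T]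
    {S : ConcreteRegularityStructure Tp T} {ιp ι : Type*} (B : HomogeneousBases S ιp ι)
    (σ τ η : ι) : η ∈ B.between σ τ ↔ B.lt σ η ∧ B.lt η τ := by
  classical
  simp only [between, Finset.mem_filter, Finsupp.mem_support_iff]
  exact ⟨fun h => h.2, fun h => ⟨h.2.1, h⟩⟩

/-- The coordinates of a homogeneous element vanish along basis elements of other degrees. -/
theorem coord_eq_zero {Tp T : Type*} [Ring Tp] [HopfAlgebra ℝ Tp] [AddCommGroup T] [Module ℝ T]
    {S : ConcreteRegularityStructure Tp T} {ιp ι : Type*} (B : HomogeneousBases S ιp ι)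
    {α : ℝ} {x : Tp} (hx : x ∈ S.gradeP α) {i : ιp} (hi : B.degP i ≠ α) :
    B.basisP.repr x i = 0 := by
  classical
  set r := (B.basisP.repr x).filter (fun j => B.degP j ≠ α) with hr
  set s := (B.basisP.repr x).filter (fun j => ¬ B.degP j ≠ α) with hs
  have hsum : r + s = B.basisP.repr x := Finsupp.filter_add_filter_not _ _
  have h1 : B.basisP.repr.symm s ∈ S.gradeP α := by
    rw [Module.Basis.repr_symm_apply, Finsupp.linearCombination_apply]
    refine Submodule.sum_mem _ fun j hj => Submodule.smul_mem _ _ ?_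
    have : B.degP j = α := by
      by_contra h
      exact (Finsupp.mem_support_iff.1 hj) (Finsupp.filter_apply_neg _ _ (by simpa using h))
    exact this ▸ B.basisP_mem j
  have h2 : B.basisP.repr.symm r ∈ ⨆ β, ⨆ (_ : β ≠ α), S.gradeP β := by
    rw [Module.Basis.repr_symm_apply, Finsupp.linearCombination_apply]
    refine Submodule.sum_mem _ fun j hj => Submodule.smul_mem _ _ ?_
    have : B.degP j ≠ α := by
      by_contra h
      exact (Finsupp.mem_support_iff.1 hj) (Finsupp.filter_apply_neg _ _ (by simpa using h))
    exact Submodule.mem_iSup_of_mem _ (Submodule.mem_iSup_of_mem this (B.basisP_mem j))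
  have h3 : B.basisP.repr.symm r ∈ S.gradeP α := by
    have : B.basisP.repr.symm r = x - B.basisP.repr.symm s := by
      rw [eq_sub_iff_add_eq, ← map_add, hsum, LinearEquiv.symm_apply_apply]
    rw [this]
    exact Submodule.sub_mem _ hx h1
  have h4 : B.basisP.repr.symm r = 0 :=
    (Submodule.disjoint_def.1 (S.gradeP_internal.submodule_iSupIndep α)) _ h3 h2
  have h5 : r = 0 := (LinearEquiv.map_eq_zero_iff _).1 h4
  have h6 : r i = B.basisP.repr x i := Finsupp.filter_apply_pos _ _ hi
  rw [← h6, h5]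
  rfl

theorem degP_mem {Tp T : Type*} [Ring Tp] [HopfAlgebra ℝ Tp] [AddCommGroup T] [Module ℝ T]
    {S : ConcreteRegularityStructure Tp T} {ιp ι : Type*} (B : HomogeneousBases S ιp ι)
    (i : ιp) : B.degP i ∈ S.Ap := by
  by_contra h
  have := B.basisP_mem i
  rw [S.gradeP_eq_bot _ h, Submodule.mem_bot] at this
  exact B.basisP.ne_zero i this

/-- If `1 <⁺ ν <⁺ τ` then `|ν| < |τ|`. -/
theorem degP_lt {Tp T : Type*} [Ring Tp] [HopfAlgebra ℝ Tp] [AddCommGroup T] [Module ℝ T]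
    {S : ConcreteRegularityStructure Tp T} {ιp ι : Type*} (B : HomogeneousBases S ιp ι)
    {ν τ : ιp} (h : ν ∈ B.betweenP B.one τ) : B.degP ν < B.degP τ := by
  classical
  rw [mem_betweenP] at h
  obtain ⟨⟨-, h1⟩, h2, h3⟩ := h
  have hone : B.basisP.repr 1 ν = 0 := by
    rw [← B.basisP_one, Module.Basis.repr_self, Finsupp.single_eq_of_ne (Ne.symm h1)]
  rcases (S.Ap_nonneg _ (B.degP_mem τ)).eq_or_lt with h0 | h0
  · exfalso
    have hm := B.basisP_mem τ
    rw [← h0, S.gradeP_zero, Submodule.mem_span_singleton] at hm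
    obtain ⟨c, hc⟩ := hm
    apply h2
    rw [quotP, ← hc, map_smul, Bialgebra.comul_one, map_smul, Algebra.TensorProduct.one_def]
    simp [hone]
  · by_contra hlt
    apply h2
    have key : ∀ z ∈ ⨆ β ∈ Set.Ioo 0 (B.degP τ),
        tensorSubmodule (S.gradeP β) (S.gradeP (B.degP τ - β)),
        TensorProduct.equivFinsuppOfBasisLeft B.basisP z ν = 0 := by
      intro z hz
      have hle : (⨆ β ∈ Set.Ioo 0 (B.degP τ),
          tensorSubmodule (S.gradeP β) (S.gradeP (B.degP τ - β))) ≤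
          LinearMap.ker (Finsupp.lapply (R := ℝ) ν ∘ₗ
            (TensorProduct.equivFinsuppOfBasisLeft (N := Tp) B.basisP).toLinearMap) := by
        refine iSup₂_le fun β hβ => ?_
        rintro _ ⟨w, rfl⟩
        rw [LinearMap.mem_ker]
        induction w using TensorProduct.induction_on with
        | zero => simp
        | add a b ha hb => rw [map_add, map_add, ha, hb, add_zero]
        | tmul a b =>
          have : B.basisP.repr (a : Tp) ν = 0 :=
            B.coord_eq_zero a.2 (fun e => hlt (e ▸ hβ.2))
          simp [this]
      exact LinearMap.mem_ker.1 (hle hz)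
    have hk := key _ (S.comul_mem _ h0 _ (B.basisP_mem τ))
    rw [map_sub, map_sub, Finsupp.sub_apply, Finsupp.sub_apply,
      TensorProduct.equivFinsuppOfBasisLeft_apply_tmul_apply,
      TensorProduct.equivFinsuppOfBasisLeft_apply_tmul_apply, hone,
      Module.Basis.repr_self, Finsupp.single_eq_of_ne h3] at hk
    simpa [quotP] using hk

/-- The number of elements of `A⁺` below `|τ|`; it is used only to justify recursions on `|τ|`. -/
def rankP {Tp T : Type*} [Ring Tp] [HopfAlgebra ℝ Tp] [AddCommGroup T] [Module ℝ T]
    {S : ConcreteRegularityStructure Tp T} {ιp ι : Type*} (B : HomogeneousBases S ιp ι)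
    (τ : ιp) : ℕ :=
  (S.Ap ∩ Set.Iio (B.degP τ)).ncard

theorem rankP_lt {Tp T : Type*} [Ring Tp] [HopfAlgebra ℝ Tp] [AddCommGroup T] [Module ℝ T]
    {S : ConcreteRegularityStructure Tp T} {ιp ι : Type*} (B : HomogeneousBases S ιp ι)
    {ν τ : ιp} (h : ν ∈ B.betweenP B.one τ) : B.rankP ν < B.rankP τ := by
  have hlt := B.degP_lt h
  have hfin : (S.Ap ∩ Set.Iio (B.degP τ)).Finite := by
    by_contra hinf
    obtain ⟨x, -, hx⟩ := Set.Infinite.exists_accPt_of_subset_isCompact hinf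
      (isCompact_Icc (a := (0 : ℝ)) (b := B.degP τ))
      (fun y hy => ⟨S.Ap_nonneg y hy.1, le_of_lt hy.2⟩)
    exact S.Ap_discrete x (hx.mono (Filter.principal_mono.2 Set.inter_subset_left))
  refine Set.ncard_lt_ncard ⟨fun y hy => ⟨hy.1, lt_trans hy.2 hlt⟩, fun hsub => ?_⟩ hfin
  exact lt_irrefl (B.degP ν) (hsub ⟨B.degP_mem ν, hlt⟩).2

end HomogeneousBases

/-! ### The map `g` of a model -/

/-- `g_{yx} = g_y * g_x⁻¹`, for the convolution of characters, with `g_x⁻¹ = g_x ∘ antipode`. -/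
def charIncrement {X Tp : Type*} [Ring Tp] [HopfAlgebra ℝ Tp] (g : X → Tp →ₐ[ℝ] ℝ) (y x : X) :
    Tp →ₗ[ℝ] ℝ :=
  LinearMap.mul' ℝ ℝ ∘ₗ
    TensorProduct.map (g y).toLinearMap ((g x).toLinearMap ∘ₗ HopfAlgebra.antipode ℝ) ∘ₗ
      Coalgebra.comul

/-- The bounds imposed on the component `g : ℝᵈ → G⁺` of a model. The constant may depend on the
basis element, which is weaker than a bound uniform over the basis. -/
def IsModelMap {d : ℕ} {Tp T : Type*} [Ring Tp] [HopfAlgebra ℝ Tp] [AddCommGroup T] [Module ℝ T]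
    {S : ConcreteRegularityStructure Tp T} {ιp ι : Type*} (B : HomogeneousBases S ιp ι)
    (g : EuclideanSpace ℝ (Fin d) → Tp →ₐ[ℝ] ℝ) : Prop :=
  ∀ τ : ιp, ∃ C : ℝ, (∀ x, |g x (B.basisP τ)| ≤ C) ∧
    ∀ x y, |charIncrement g y x (B.basisP τ)| ≤ C * ‖y - x‖ ^ B.degP τ

/-! ### Littlewood-Paley blocks and the paraproduct -/

/-- A dyadic partition of unity of `ℝᵈ`, given by `ρ₋₁ = low` and `ρ₀ = base`. -/
structure DyadicPartition (d : ℕ) where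
  low : EuclideanSpace ℝ (Fin d) → ℝ
  base : EuclideanSpace ℝ (Fin d) → ℝ
  low_smooth : ContDiff ℝ ∞ low
  base_smooth : ContDiff ℝ ∞ base
  low_mem : ∀ ξ, low ξ ∈ Set.Icc (0 : ℝ) 1
  base_mem : ∀ ξ, base ξ ∈ Set.Icc (0 : ℝ) 1
  low_radial : ∀ ξ ζ, ‖ξ‖ = ‖ζ‖ → low ξ = low ζ
  base_radial : ∀ ξ ζ, ‖ξ‖ = ‖ζ‖ → base ξ = base ζ
  low_support : tsupport low ⊆ {ξ | ‖ξ‖ < 4 / 3}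
  base_support : tsupport base ⊆ {ξ | 3 / 4 < ‖ξ‖ ∧ ‖ξ‖ < 8 / 3}
  sum_eq_one : ∀ ξ, HasSum (fun n : ℕ => base ((2 : ℝ)⁻¹ ^ n • ξ)) (1 - low ξ)

namespace DyadicPartition

/-- The functions of the partition, with the index shifted by one: `symbol n = ρ_{n-1}`. -/
def symbol {d : ℕ} (P : DyadicPartition d) : ℕ → EuclideanSpace ℝ (Fin d) → ℝ
  | 0 => P.low
  | n + 1 => fun ξ => P.base ((2 : ℝ)⁻¹ ^ n • ξ)

theorem symbol_smooth {d : ℕ} (P : DyadicPartition d) (n : ℕ) :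
    ContDiff ℝ ∞ (fun ξ => (P.symbol n ξ : ℂ)) := by
  refine Complex.ofRealCLM.contDiff.comp ?_
  cases n with
  | zero => exact P.low_smooth
  | succ n => exact P.base_smooth.comp (contDiff_const_smul _)

theorem symbol_compact {d : ℕ} (P : DyadicPartition d) (n : ℕ) :
    HasCompactSupport (fun ξ => (P.symbol n ξ : ℂ)) := by
  have h : HasCompactSupport (P.symbol n) := by
    cases n with
    | zero =>
      refine HasCompactSupport.of_support_subset_isCompact
        (isCompact_closedBall (0 : EuclideanSpace ℝ (Fin d)) (4 / 3)) fun ξ hξ => ?_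
      have := P.low_support (subset_tsupport _ hξ)
      simpa using le_of_lt this
    | succ n =>
      have hb : HasCompactSupport P.base := by
        refine HasCompactSupport.of_support_subset_isCompact
          (isCompact_closedBall (0 : EuclideanSpace ℝ (Fin d)) (8 / 3)) fun ξ hξ => ?_
        have := P.base_support (subset_tsupport _ hξ)
        simpa using le_of_lt this.2
      exact hb.comp_smul (pow_ne_zero n (by norm_num))
  exact h.comp_left (g := fun r : ℝ => (r : ℂ)) Complex.ofReal_zero

/-- `symbol n = ρ_{n-1}` as a Schwartz function. -/
def symbolSchwartz {d : ℕ} (P : DyadicPartition d) (n : ℕ) : 𝓢(EuclideanSpace ℝ (Fin d), ℂ) :=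
  (P.symbol_compact n).toSchwartzMap (P.symbol_smooth n)

/-- The Littlewood-Paley block `Δ_{n-1} f = 𝓕⁻¹ (ρ_{n-1} 𝓕 f)` of a tempered distribution. -/
def block {d : ℕ} (P : DyadicPartition d) (n : ℕ) :
    𝓢'(EuclideanSpace ℝ (Fin d), ℂ) →L[ℂ] 𝓢'(EuclideanSpace ℝ (Fin d), ℂ) :=
  TemperedDistribution.fourierMultiplierCLM ℂ (fun ξ => (P.symbol n ξ : ℂ))

/-- The smooth function `x ↦ ⟨f, Q_{n-1}(x - ·)⟩`, with `Q_{n-1} = 𝓕⁻¹ ρ_{n-1}`, which represents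
the block `Δ_{n-1} f`. Note that `(𝓕 ρ_{n-1})(y - x) = Q_{n-1}(x - y)`. -/
def blockFun {d : ℕ} (P : DyadicPartition d) (n : ℕ) (f : 𝓢'(EuclideanSpace ℝ (Fin d), ℂ))
    (x : EuclideanSpace ℝ (Fin d)) : ℂ :=
  f (SchwartzMap.compSubConstCLM ℂ x (𝓕 (P.symbolSchwartz n)))

/-- The term `(∑_{-1 ≤ i ≤ j-2} Δ_i f) Δ_j g` of the paraproduct: the product of the tempered
distribution `Δ_j g` with a smooth function of temperate growth. -/
def paraTerm {d : ℕ} (P : DyadicPartition d) (f g : 𝓢'(EuclideanSpace ℝ (Fin d), ℂ)) (j : ℕ) :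
    𝓢'(EuclideanSpace ℝ (Fin d), ℂ) :=
  TemperedDistribution.smulLeftCLM ℂ (fun x => ∑ n ∈ Finset.range j, P.blockFun n f x)
    (P.block (j + 1) g)

/-- Convergence in `𝓢'` of the series that defines the paraproduct `P_f g`. -/
def ParaConverges {d : ℕ} (P : DyadicPartition d)
    (f g : 𝓢'(EuclideanSpace ℝ (Fin d), ℂ)) : Prop :=
  Summable (P.paraTerm f g)

/-- Bony's paraproduct `P_f g = ∑_{i ≤ j-2} Δ_i f Δ_j g`, as a sum in `𝓢'`. It is meaningful when
`ParaConverges` holds. (The term `j = 0` vanishes, as does the one of index `-1`.) -/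
def para {d : ℕ} (P : DyadicPartition d) (f g : 𝓢'(EuclideanSpace ℝ (Fin d), ℂ)) :
    𝓢'(EuclideanSpace ℝ (Fin d), ℂ) :=
  ∑' j, P.paraTerm f g j

end DyadicPartition

open Classical in
/-- A bounded measurable function on `ℝᵈ` as a tempered distribution. -/
def funDistribution {d : ℕ} (f : EuclideanSpace ℝ (Fin d) → ℝ) :
    𝓢'(EuclideanSpace ℝ (Fin d), ℂ) :=
  if h : MemLp (fun x => (f x : ℂ)) ⊤ volume then
    MeasureTheory.Lp.toTemperedDistribution (h.toLp _)
  else 0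

/-! ### The brackets -/

/-- The bracket `⟦τ⟧^g` of `τ ∈ 𝓑⁺`, defined by recursion on `|τ|` through
`g(τ) = ∑_{1 <⁺ ν <⁺ τ} P_{g(τ /⁺ ν)} ⟦ν⟧^g + ⟦τ⟧^g`. -/
def bracketBasis {d : ℕ} {Tp T : Type*} [Ring Tp] [HopfAlgebra ℝ Tp] [AddCommGroup T] [Module ℝ T]
    {S : ConcreteRegularityStructure Tp T} {ιp ι : Type*} (B : HomogeneousBases S ιp ι)
    (P : DyadicPartition d) (g : EuclideanSpace ℝ (Fin d) → Tp →ₐ[ℝ] ℝ)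
    (τ : ιp) : 𝓢'(EuclideanSpace ℝ (Fin d), ℂ) :=
  funDistribution (fun x => g x (B.basisP τ)) -
    ∑ ν ∈ (B.betweenP B.one τ).attach,
      P.para (funDistribution (fun x => g x (B.quotP τ ν.1))) (bracketBasis B P g ν.1)
termination_by B.rankP τ
decreasing_by exact B.rankP_lt ν.2

/-- The defining relation of the brackets. -/
theorem bracketBasis_spec {d : ℕ} {Tp T : Type*} [Ring Tp] [HopfAlgebra ℝ Tp]
    [AddCommGroup T] [Module ℝ T]
    {S : ConcreteRegularityStructure Tp T} {ιp ι : Type*} (B : HomogeneousBases S ιp ι)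
    (P : DyadicPartition d) (g : EuclideanSpace ℝ (Fin d) → Tp →ₐ[ℝ] ℝ) (τ : ιp) :
    funDistribution (fun x => g x (B.basisP τ)) =
      (∑ ν ∈ B.betweenP B.one τ,
        P.para (funDistribution (fun x => g x (B.quotP τ ν))) (bracketBasis B P g ν)) +
      bracketBasis B P g τ := by
  conv_rhs => rw [bracketBasis]
  rw [Finset.sum_attach (B.betweenP B.one τ) (fun ν =>
    P.para (funDistribution (fun x => g x (B.quotP τ ν))) (bracketBasis B P g ν))]
  abel

/-- The linear extension of the bracket `⟦·⟧^g` to `T⁺`. -/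
def bracket {d : ℕ} {Tp T : Type*} [Ring Tp] [HopfAlgebra ℝ Tp] [AddCommGroup T] [Module ℝ T]
    {S : ConcreteRegularityStructure Tp T} {ιp ι : Type*} (B : HomogeneousBases S ιp ι)
    (P : DyadicPartition d) (g : EuclideanSpace ℝ (Fin d) → Tp →ₐ[ℝ] ℝ) :
    Tp →ₗ[ℝ] 𝓢'(EuclideanSpace ℝ (Fin d), ℂ) :=
  B.basisP.constr ℝ (bracketBasis B P g)

end

/-!
For `t ∈ T⁺` of positive degree the definition of the brackets reads
`g(t) = ∑ P_{g(b)} ⟦a⟧^g + ⟦t⟧^g`, where `∑ a ⊗ b = Δ⁺ t - t ⊗ 1 - 1 ⊗ t` is the reduced coproduct: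
both sides are linear in `t`, and for `t ∈ 𝓑⁺` this is the recursion itself. The comodule identity
for `Δ`, read along `σ`, says that `Δ⁺(τ/σ) = ∑ (η/σ) ⊗ (τ/η)`, whence the claim is the case
`t = τ/σ`.

Linearity requires that the paraproducts be bilinear on a space that contains all brackets. The
terms of `P_f h` have their spectra in annuli of size `2ʲ`, so for `f ∈ L^∞` and `h` in
`B⁰_{∞,∞}` they are uniformly bounded and each block meets finitely many of them: the series
converges in `𝓢'` and its sum is again in `B⁰_{∞,∞}`.
-/

noncomputable section

/-! ### Convolutions of Schwartz functions -/

section Schwartz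

variable {E : Type*} [NormedAddCommGroup E] [InnerProductSpace ℝ E] [FiniteDimensional ℝ E]
  [MeasurableSpace E] [BorelSpace E]

theorem schwartz_fourierInv_apply {F : Type*} [NormedAddCommGroup F] [NormedSpace ℂ F]
    (f : 𝓢(E, F)) (x : E) : 𝓕⁻ f x = 𝓕 f (-x) := by
  rw [SchwartzMap.fourierInv_apply_eq]
  rfl

theorem schwartz_fourier_fourier_apply {F : Type*} [NormedAddCommGroup F] [NormedSpace ℂ F]
    [CompleteSpace F] (f : 𝓢(E, F)) (x : E) : 𝓕 (𝓕 f) x = f (-x) := by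
  rw [← neg_neg x, ← schwartz_fourierInv_apply, FourierTransform.fourierInv_fourier_eq, neg_neg]

local infixl:67 " ⋆ₛ " => SchwartzMap.convolution (ContinuousLinearMap.mul ℂ ℂ)

theorem schwartz_convolution_mul_apply (K φ : 𝓢(E, ℂ)) (y : E) :
    (K ⋆ₛ φ) y = ∫ x, K (y - x) * φ x := by
  rw [SchwartzMap.convolution_apply, convolution_eq_swap]
  rfl

theorem fourier_fourier_convolution_apply (a φ : 𝓢(E, ℂ)) (x : E) :
    𝓕 (𝓕 a ⋆ₛ φ) x = a (-x) * 𝓕 φ x := by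
  rw [SchwartzMap.fourier_convolution, SchwartzMap.pairing_apply_apply,
    schwartz_fourier_fourier_apply]
  rfl

theorem fourier_smulLeft_fourierInv (a φ : 𝓢(E, ℂ)) :
    𝓕 (SchwartzMap.smulLeftCLM ℂ a (𝓕⁻ φ)) = 𝓕 a ⋆ₛ φ := by
  apply (FourierTransform.fourierCLE ℂ 𝓢(E, ℂ)).injective
  ext x
  simp only [FourierTransform.fourierCLE_apply]
  rw [schwartz_fourier_fourier_apply, fourier_fourier_convolution_apply,
    SchwartzMap.smulLeftCLM_apply_apply a.hasTemperateGrowth, schwartz_fourierInv_apply, neg_neg,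
    smul_eq_mul]

theorem integral_norm_convolution_le (K φ : 𝓢(E, ℂ)) :
    ∫ x, ‖(K ⋆ₛ φ) x‖ ≤ (∫ x, ‖K x‖) * ∫ x, ‖φ x‖ := by
  have hint : Integrable (convolution (fun x => ‖K x‖) (fun x => ‖φ x‖)
      (ContinuousLinearMap.mul ℝ ℝ) volume) :=
    K.integrable.norm.integrable_convolution _ φ.integrable.norm
  calc ∫ x, ‖(K ⋆ₛ φ) x‖
      ≤ ∫ x, convolution (fun x => ‖K x‖) (fun x => ‖φ x‖) (ContinuousLinearMap.mul ℝ ℝ)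
          volume x := by
        refine integral_mono (SchwartzMap.integrable _).norm hint fun x => ?_
        simp only [SchwartzMap.convolution_apply, convolution_def,
          ContinuousLinearMap.mul_apply', ← norm_mul]
        exact norm_integral_le_integral_norm _
    _ = (∫ x, ‖K x‖) * ∫ x, ‖φ x‖ :=
        integral_convolution (ContinuousLinearMap.mul ℝ ℝ) K.integrable.norm φ.integrable.norm

/-! ### Translations and regularization in `L¹` -/

theorem lintegral_enorm_sub_comp_sub_le {F : Type*} [NormedAddCommGroup F] [NormedSpace ℝ F]
    [CompleteSpace F] {φ : E → F} (hφ : ContDiff ℝ 1 φ) (v : E) :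
    ∫⁻ x, ‖φ x - φ (x - v)‖ₑ ≤ ‖v‖ₑ * ∫⁻ x, ‖fderiv ℝ φ x‖ₑ := by
  have hcont : Continuous (fderiv ℝ φ) := hφ.continuous_fderiv one_ne_zero
  have hmeas : Measurable fun p : E × ℝ => ‖v‖ₑ * ‖fderiv ℝ φ (p.1 - p.2 • v)‖ₑ :=
    (by fun_prop :
      Continuous fun p : E × ℝ => fderiv ℝ φ (p.1 - p.2 • v)).enorm.measurable.const_mul _
  have hderiv (x : E) (s : ℝ) :
      HasDerivAt (fun s : ℝ => φ (x - s • v)) (fderiv ℝ φ (x - s • v) (-v)) s := by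
    have h := (hφ.differentiable one_ne_zero (x - s • v)).hasFDerivAt
    refine h.comp_hasDerivAt s (.const_sub x ?_)
    simpa using (hasDerivAt_id s).smul_const v
  have hsegment (x : E) :
      ‖φ x - φ (x - v)‖ₑ ≤ ∫⁻ s in Set.Ioc (0 : ℝ) 1, ‖v‖ₑ * ‖fderiv ℝ φ (x - s • v)‖ₑ := by
    have h := intervalIntegral.integral_eq_sub_of_hasDerivAt (fun s _ => hderiv x s)
      ((by fun_prop : Continuous fun s : ℝ => fderiv ℝ φ (x - s • v) (-v)).intervalIntegrable 0 1)
    simp only [one_smul, zero_smul, sub_zero] at h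
    rw [← enorm_neg, neg_sub, ← h, intervalIntegral.integral_of_le zero_le_one]
    refine (enorm_integral_le_lintegral_enorm _).trans (lintegral_mono fun s => ?_)
    refine (ContinuousLinearMap.le_opENorm _ _).trans ?_
    rw [enorm_neg, mul_comm]
  calc ∫⁻ x, ‖φ x - φ (x - v)‖ₑ
      ≤ ∫⁻ x, ∫⁻ s in Set.Ioc (0 : ℝ) 1, ‖v‖ₑ * ‖fderiv ℝ φ (x - s • v)‖ₑ :=
        lintegral_mono hsegment
    _ = ∫⁻ s in Set.Ioc (0 : ℝ) 1, ∫⁻ x, ‖v‖ₑ * ‖fderiv ℝ φ (x - s • v)‖ₑ :=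
        lintegral_lintegral_swap hmeas.aemeasurable
    _ = ‖v‖ₑ * ∫⁻ x, ‖fderiv ℝ φ x‖ₑ := by
        have (s : ℝ) : ∫⁻ x, ‖v‖ₑ * ‖fderiv ℝ φ (x - s • v)‖ₑ =
            ‖v‖ₑ * ∫⁻ x, ‖fderiv ℝ φ x‖ₑ := by
          rw [lintegral_sub_right_eq_self (fun x => ‖v‖ₑ * ‖fderiv ℝ φ x‖ₑ),
            lintegral_const_mul _ hcont.enorm.measurable]
        simp [this]

theorem schwartz_integrable_norm_fderiv {F : Type*} [NormedAddCommGroup F] [NormedSpace ℝ F]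
    (φ : 𝓢(E, F)) : Integrable fun x => ‖fderiv ℝ φ x‖ := by
  simpa [norm_iteratedFDeriv_one] using φ.integrable_pow_mul_iteratedFDeriv volume 0 1

theorem sub_convolution_apply {K : 𝓢(E, ℂ)} (hK : ∫ w, K w = 1) (φ : 𝓢(E, ℂ)) (x : E) :
    (φ - K ⋆ₛ φ) x = ∫ w, K w * (φ x - φ (x - w)) := by
  have hint : Integrable fun w => K w * φ (x - w) :=
    K.integrable.mul_bdd (φ.continuous.comp (continuous_sub_left x)).aestronglyMeasurable
      (ae_of_all _ fun w => SchwartzMap.norm_le_seminorm ℝ φ _)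
  simp only [mul_sub]
  rw [integral_sub (K.integrable.mul_const _) hint, integral_mul_const, hK, one_mul, sub_apply,
    SchwartzMap.convolution_apply, convolution_def]
  rfl

theorem integral_norm_sub_convolution_le {K : 𝓢(E, ℂ)} (hK : ∫ w, K w = 1) (φ : 𝓢(E, ℂ)) :
    ∫ x, ‖(φ - K ⋆ₛ φ) x‖ ≤ (∫ w, ‖w‖ * ‖K w‖) * ∫ x, ‖fderiv ℝ φ x‖ := by
  have hK' : Integrable fun w => ‖w‖ * ‖K w‖ := by simpa using K.integrable_pow_mul volume 1
  have hmeas : Measurable fun p : E × E => ‖K p.2‖ₑ * ‖φ p.1 - φ (p.1 - p.2)‖ₑ :=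
    (K.continuous.comp continuous_snd).enorm.measurable.mul
      ((φ.continuous.comp continuous_fst).sub
        (φ.continuous.comp (continuous_fst.sub continuous_snd))).enorm.measurable
  have h : ∫⁻ x, ‖(φ - K ⋆ₛ φ) x‖ₑ ≤ (∫⁻ w, ‖‖w‖ * ‖K w‖‖ₑ) * ∫⁻ x, ‖‖fderiv ℝ φ x‖‖ₑ := calc
    ∫⁻ x, ‖(φ - K ⋆ₛ φ) x‖ₑ
    _ ≤ ∫⁻ x, ∫⁻ w, ‖K w‖ₑ * ‖φ x - φ (x - w)‖ₑ := by
        refine lintegral_mono fun x => ?_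
        rw [sub_convolution_apply hK]
        simpa only [enorm_mul] using
          enorm_integral_le_lintegral_enorm fun w => K w * (φ x - φ (x - w))
    _ = ∫⁻ w, ∫⁻ x, ‖K w‖ₑ * ‖φ x - φ (x - w)‖ₑ := lintegral_lintegral_swap hmeas.aemeasurable
    _ = ∫⁻ w, ‖K w‖ₑ * ∫⁻ x, ‖φ x - φ (x - w)‖ₑ := by
        refine lintegral_congr fun w => lintegral_const_mul _ (Continuous.measurable ?_)
        exact (φ.continuous.sub (φ.continuous.comp (continuous_sub_right w))).enorm
    _ ≤ ∫⁻ w, ‖K w‖ₑ * (‖w‖ₑ * ∫⁻ x, ‖fderiv ℝ φ x‖ₑ) :=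
        lintegral_mono fun w => mul_le_mul_right (lintegral_enorm_sub_comp_sub_le (φ.smooth 1) w) _
    _ = ∫⁻ w, ‖‖w‖ * ‖K w‖‖ₑ * ∫⁻ x, ‖‖fderiv ℝ φ x‖‖ₑ := by
        simp only [enorm_mul, enorm_norm, mul_left_comm, mul_assoc]
    _ = (∫⁻ w, ‖‖w‖ * ‖K w‖‖ₑ) * ∫⁻ x, ‖‖fderiv ℝ φ x‖‖ₑ :=
        lintegral_mul_const'' _ hK'.aestronglyMeasurable.enorm
  have hfin := ENNReal.mul_ne_top hK'.hasFiniteIntegral.ne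
    (schwartz_integrable_norm_fderiv φ).hasFiniteIntegral.ne
  have h' := ENNReal.toReal_mono hfin h
  rw [ENNReal.toReal_mul, ← integral_norm_eq_lintegral_enorm hK'.aestronglyMeasurable,
    ← integral_norm_eq_lintegral_enorm (schwartz_integrable_norm_fderiv φ).aestronglyMeasurable,
    ← integral_norm_eq_lintegral_enorm (SchwartzMap.integrable _).aestronglyMeasurable] at h'
  simpa only [norm_mul, norm_norm] using h'

/-! ### Bounded distributions -/

/-- `T` is bounded by `C` as a functional on `L¹`, that is, `T` is a function with essential
supremum at most `C`. Stating this by duality avoids choosing a representative. -/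
def IsBoundedBy (T : 𝓢'(E, ℂ)) (C : ℝ) : Prop :=
  0 ≤ C ∧ ∀ φ : 𝓢(E, ℂ), ‖T φ‖ ≤ C * ∫ x, ‖φ x‖

namespace IsBoundedBy

variable {T T' : 𝓢'(E, ℂ)} {C C' : ℝ}

theorem mono (h : IsBoundedBy T C) (hC : C ≤ C') : IsBoundedBy T C' :=
  ⟨h.1.trans hC, fun φ => (h.2 φ).trans (by gcongr)⟩

theorem zero : IsBoundedBy (0 : 𝓢'(E, ℂ)) 0 :=
  ⟨le_rfl, fun φ => by simp⟩

theorem add (h : IsBoundedBy T C) (h' : IsBoundedBy T' C') : IsBoundedBy (T + T') (C + C') := by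
  refine ⟨add_nonneg h.1 h'.1, fun φ => ?_⟩
  rw [add_mul]
  exact (norm_add_le _ _).trans (add_le_add (h.2 φ) (h'.2 φ))

theorem smul (c : ℂ) (h : IsBoundedBy T C) : IsBoundedBy (c • T) (‖c‖ * C) := by
  refine ⟨mul_nonneg (norm_nonneg _) h.1, fun φ => ?_⟩
  have hφ : ‖(c • T) φ‖ = ‖c‖ * ‖T φ‖ := norm_smul c (T φ)
  rw [hφ, mul_assoc]
  exact mul_le_mul_of_nonneg_left (h.2 φ) (norm_nonneg _)

theorem sum {κ : Type*} (s : Finset κ) {T : κ → 𝓢'(E, ℂ)} {C : κ → ℝ}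
    (h : ∀ k ∈ s, IsBoundedBy (T k) (C k)) : IsBoundedBy (∑ k ∈ s, T k) (∑ k ∈ s, C k) := by
  classical
  induction s using Finset.induction_on with
  | empty => simpa only [Finset.sum_empty] using zero
  | insert a s ha ih =>
    rw [Finset.sum_insert ha, Finset.sum_insert ha]
    exact (h a (s.mem_insert_self a)).add (ih fun k hk => h k (Finset.mem_insert_of_mem hk))

theorem fourierMultiplier (h : IsBoundedBy T C) (a : 𝓢(E, ℂ)) :
    IsBoundedBy (TemperedDistribution.fourierMultiplierCLM ℂ a T) (C * ∫ z, ‖𝓕 a z‖) := by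
  refine ⟨mul_nonneg h.1 (integral_nonneg fun _ => norm_nonneg _), fun φ => ?_⟩
  rw [TemperedDistribution.fourierMultiplierCLM_apply_apply, fourier_smulLeft_fourierInv, mul_assoc]
  exact (h.2 _).trans (mul_le_mul_of_nonneg_left (integral_norm_convolution_le _ φ) h.1)

theorem smulLeft (h : IsBoundedBy T C) {m : E → ℂ} (hm : m.HasTemperateGrowth) {M : ℝ}
    (hM : ∀ x, ‖m x‖ ≤ M) :
    IsBoundedBy (TemperedDistribution.smulLeftCLM ℂ m T) (M * C) := by
  have hM0 : 0 ≤ M := (norm_nonneg _).trans (hM 0)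
  refine ⟨mul_nonneg hM0 h.1, fun φ => ?_⟩
  have hint : ∫ x, ‖SchwartzMap.smulLeftCLM ℂ m φ x‖ ≤ M * ∫ x, ‖φ x‖ := by
    rw [← integral_const_mul]
    refine integral_mono (SchwartzMap.integrable _).norm (φ.integrable.norm.const_mul M)
      fun x => ?_
    rw [SchwartzMap.smulLeftCLM_apply_apply hm, norm_smul]
    exact mul_le_mul_of_nonneg_right (hM x) (norm_nonneg _)
  rw [TemperedDistribution.smulLeftCLM_apply_apply, mul_comm M, mul_assoc]
  exact (h.2 _).trans (mul_le_mul_of_nonneg_left hint h.1)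

end IsBoundedBy

theorem norm_ae_le_norm_of_Lp_top {α F : Type*} [MeasurableSpace α] {μ : Measure α}
    [NormedAddCommGroup F] (u : Lp F ⊤ μ) : ∀ᵐ x ∂μ, ‖u x‖ ≤ ‖u‖ := by
  have h : ∀ᵐ x ∂μ, ‖u x‖ₑ ≤ eLpNorm u ⊤ μ := by
    simpa only [eLpNorm_exponent_top] using ae_le_eLpNormEssSup
  filter_upwards [h] with x hx
  rw [Lp.norm_def, ← toReal_enorm]
  exact ENNReal.toReal_mono (Lp.eLpNorm_ne_top u) hx

theorem isBoundedBy_toTemperedDistribution (u : Lp ℂ ⊤ (volume : Measure E)) :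
    IsBoundedBy (Lp.toTemperedDistribution u) ‖u‖ := by
  refine ⟨norm_nonneg u, fun φ => ?_⟩
  rw [Lp.toTemperedDistribution_apply, mul_comm, ← integral_mul_const]
  refine norm_integral_le_of_norm_le (φ.integrable.norm.mul_const _) ?_
  filter_upwards [norm_ae_le_norm_of_Lp_top u] with x hx
  rw [norm_smul]
  exact mul_le_mul_of_nonneg_left hx (norm_nonneg _)

/-! ### Mollified distributions -/

/-- The function `x ↦ ⟨T, K(· - x)⟩`, which is the convolution of `T` with `z ↦ K(-z)`. -/
def smear (K : 𝓢(E, ℂ)) (T : 𝓢'(E, ℂ)) (x : E) : ℂ :=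
  T (SchwartzMap.compSubConstCLM ℂ x K)

theorem smear_toTemperedDistribution (K : 𝓢(E, ℂ)) (u : Lp ℂ ⊤ (volume : Measure E)) (x : E) :
    smear K (Lp.toTemperedDistribution u) x = ∫ y, K (y - x) * u y := by
  rw [smear, Lp.toTemperedDistribution_apply]
  rfl

theorem IsBoundedBy.norm_smear_le {T : 𝓢'(E, ℂ)} {C : ℝ} (h : IsBoundedBy T C) (K : 𝓢(E, ℂ))
    (x : E) : ‖smear K T x‖ ≤ C * ∫ z, ‖K z‖ := by
  rw [← integral_sub_right_eq_self (fun z => ‖K z‖) x]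
  exact h.2 _

theorem integral_mul_smear_toTemperedDistribution (K φ : 𝓢(E, ℂ))
    (u : Lp ℂ ⊤ (volume : Measure E)) :
    ∫ x, φ x * smear K (Lp.toTemperedDistribution u) x =
      Lp.toTemperedDistribution u (K ⋆ₛ φ) := by
  have hint : Integrable (fun p : E × E => φ p.1 * (K (p.2 - p.1) * u p.2))
      (volume.prod volume) := by
    have h := (Integrable.convolution_integrand (ContinuousLinearMap.mul ℂ ℂ)
      (φ.integrable (μ := volume)) (K.integrable (μ := volume))).swap
    refine (h.mul_bdd ((Lp.aestronglyMeasurable u).comp_snd (μ := volume))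
      (Measure.quasiMeasurePreserving_snd.ae (norm_ae_le_norm_of_Lp_top u))).congr
      (ae_of_all _ fun p => ?_)
    simp [mul_assoc]
  calc ∫ x, φ x * smear K (Lp.toTemperedDistribution u) x
      = ∫ x, ∫ y, φ x * (K (y - x) * u y) := by
        simp only [smear_toTemperedDistribution, integral_const_mul]
    _ = ∫ y, ∫ x, φ x * (K (y - x) * u y) := integral_integral_swap hint
    _ = ∫ y, (K ⋆ₛ φ) y • u y := by
        simp only [schwartz_convolution_mul_apply, smul_eq_mul, ← integral_mul_const]
        congr! 4
        ring
    _ = Lp.toTemperedDistribution u (K ⋆ₛ φ) := by rw [Lp.toTemperedDistribution_apply]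

/-! ### Smoothness of mollified bounded functions -/

theorem hasFDerivAt_integral_smul_comp_sub {V : Type*} [NormedAddCommGroup V] [NormedSpace ℝ V]
    [NormedSpace ℂ V] [SMulCommClass ℝ ℂ V] {u : E → ℂ} (hu : AEStronglyMeasurable u volume)
    {C : ℝ} (hC : ∀ᵐ y, ‖u y‖ ≤ C) {k : E → V} (hk : Integrable k) {k' : E → E →L[ℝ] V}
    (hkk' : ∀ z, HasFDerivAt k (k' z) z) (hk' : Continuous k') {M r : ℝ}
    (hr : Module.finrank ℝ E < r) (hM : ∀ z, ‖k' z‖ ≤ M * (1 + ‖z‖) ^ (-r)) (x₀ : E) :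
    HasFDerivAt (fun x => ∫ y, u y • k (x - y)) (∫ y, u y • k' (x₀ - y)) x₀ := by
  have hr0 : 0 ≤ r := (Nat.cast_nonneg _).trans hr.le
  have hM0 : 0 ≤ M := by simpa using (norm_nonneg _).trans (hM 0)
  have hkcont : Continuous k := continuous_iff_continuousAt.2 fun z => (hkk' z).continuousAt
  have hweight {x y : E} (hx : x ∈ Metric.ball x₀ 1) :
      (1 + ‖x - y‖) ^ (-r) ≤ 2 ^ r * (1 + ‖x₀ - y‖) ^ (-r) := by
    have hdist : ‖x₀ - x‖ ≤ 1 := by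
      rw [← dist_eq_norm, dist_comm]
      exact (Metric.mem_ball.1 hx).le
    have htri : (1 + ‖x₀ - y‖) / 2 ≤ 1 + ‖x - y‖ := by
      linarith [norm_sub_le_norm_sub_add_norm_sub x₀ x y, norm_nonneg (x - y)]
    refine (Real.rpow_le_rpow_of_nonpos (by positivity) htri (neg_nonpos.2 hr0)).trans_eq ?_
    rw [Real.div_rpow (by positivity) zero_le_two, Real.rpow_neg zero_le_two, div_inv_eq_mul,
      mul_comm]
  refine hasFDerivAt_integral_of_dominated_of_fderiv_le (𝕜 := ℝ) (F := fun x y => u y • k (x - y))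
    (F' := fun x y => u y • k' (x - y)) (Metric.ball_mem_nhds x₀ one_pos)
    (bound := fun y => C * (M * (2 ^ r * (1 + ‖x₀ - y‖) ^ (-r)))) ?_ ?_ ?_ ?_ ?_ ?_
  · exact .of_forall fun x => hu.smul (hkcont.comp (continuous_sub_left x)).aestronglyMeasurable
  · exact (hk.comp_sub_left x₀).bdd_smul C hu hC
  · exact hu.smul (hk'.comp (continuous_sub_left x₀)).aestronglyMeasurable
  · filter_upwards [hC] with y hy x hx
    rw [norm_smul]
    exact mul_le_mul hy ((hM _).trans (mul_le_mul_of_nonneg_left (hweight hx) hM0))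
      (norm_nonneg _) ((norm_nonneg _).trans hy)
  · exact ((((integrable_one_add_norm hr).comp_sub_left x₀).const_mul _).const_mul _).const_mul _
  · exact ae_of_all _ fun y x _ => ((hasFDerivAt_comp_sub y).2 (hkk' (x - y))).const_smul (u y)

theorem exists_norm_iteratedFDeriv_le_one_add_norm_rpow {V F : Type*} [NormedAddCommGroup V]
    [NormedSpace ℝ V] [NormedAddCommGroup F] [NormedSpace ℝ F] (f : 𝓢(V, F)) (n N : ℕ) :
    ∃ M, ∀ z, ‖iteratedFDeriv ℝ n f z‖ ≤ M * (1 + ‖z‖) ^ (-(N : ℝ)) := by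
  refine ⟨2 ^ N * (Finset.Iic (N, n)).sup (fun m => SchwartzMap.seminorm ℝ m.1 m.2) f,
    fun z => ?_⟩
  rw [Real.rpow_neg (by positivity), Real.rpow_natCast, ← div_eq_mul_inv,
    le_div_iff₀ (by positivity), mul_comm]
  exact SchwartzMap.one_add_le_sup_seminorm_apply (𝕜 := ℝ) (m := (N, n)) le_rfl le_rfl f z

theorem hasFTaylorSeriesUpTo_integral_smul_comp_sub {F : Type*} [NormedAddCommGroup F]
    [NormedSpace ℝ F] [NormedSpace ℂ F] [IsScalarTower ℝ ℂ F] [CompleteSpace F] {u : E → ℂ}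
    (hu : AEStronglyMeasurable u volume) {C : ℝ} (hC : ∀ᵐ y, ‖u y‖ ≤ C) (k : 𝓢(E, F)) :
    HasFTaylorSeriesUpTo ∞ (fun x => ∫ y, u y • k (x - y))
      fun x n => ∫ y, u y • iteratedFDeriv ℝ n k (x - y) := by
  have hsmooth (n : ℕ) : ContDiff ℝ 1 (iteratedFDeriv ℝ n k) :=
    (k.smooth ⊤).iteratedFDeriv_right (mod_cast le_top)
  have hint (n : ℕ) : Integrable (iteratedFDeriv ℝ n k) :=
    (integrable_norm_iff (hsmooth n).continuous.aestronglyMeasurable).1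
      (by simpa using k.integrable_pow_mul_iteratedFDeriv volume 0 n)
  have hderiv (n : ℕ) (x : E) :
      HasFDerivAt (fun x => ∫ y, u y • iteratedFDeriv ℝ n k (x - y))
        (∫ y, u y • iteratedFDeriv ℝ (n + 1) k (x - y)).curryLeft x := by
    obtain ⟨M, hM⟩ := exists_norm_iteratedFDeriv_le_one_add_norm_rpow k (n + 1)
      (Module.finrank ℝ E + 1)
    have h := hasFDerivAt_integral_smul_comp_sub hu hC (hint n)
      (fun z => ((hsmooth n).differentiable one_ne_zero z).hasFDerivAt)
      ((hsmooth n).continuous_fderiv one_ne_zero) (r := (Module.finrank ℝ E + 1 : ℕ))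
      (by push_cast; linarith) (fun z => by rw [norm_fderiv_iteratedFDeriv]; exact hM z) x
    simp only [fderiv_iteratedFDeriv] at h
    refine h.congr_fderiv ?_
    have hcurry := LinearIsometry.integral_comp_comm (μ := volume) (𝕜 := ℝ)
      (F := E →L[ℝ] E [×n]→L[ℝ] F)
      (continuousMultilinearCurryLeftEquiv ℝ (fun _ : Fin (n + 1) => E) F).toLinearIsometry
      fun y => u y • iteratedFDeriv ℝ (n + 1) k (x - y)
    exact hcurry
  refine ⟨fun x => ?_, fun n _ x => hderiv n x, fun n _ =>
    continuous_iff_continuousAt.2 fun x => (hderiv n x).continuousAt⟩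
  exact (ContinuousMultilinearMap.apply ℝ (fun _ : Fin 0 => E) F 0).integral_comp_comm
    (((hint 0).comp_sub_left x).bdd_smul C hu hC) |>.symm

theorem hasTemperateGrowth_smear_toTemperedDistribution (K : 𝓢(E, ℂ))
    (u : Lp ℂ ⊤ (volume : Measure E)) :
    (smear K (Lp.toTemperedDistribution u)).HasTemperateGrowth := by
  let k : 𝓢(E, ℂ) :=
    SchwartzMap.compCLMOfContinuousLinearEquiv ℂ (ContinuousLinearEquiv.neg ℝ) K
  have hsmear : smear K (Lp.toTemperedDistribution u) = fun x => ∫ y, u y • k (x - y) := by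
    ext x
    rw [smear_toTemperedDistribution]
    congr! 2 with y
    simp [k, mul_comm]
  have hbound := norm_ae_le_norm_of_Lp_top u
  have htaylor := hasFTaylorSeriesUpTo_integral_smul_comp_sub
    (Lp.aestronglyMeasurable u) hbound k
  rw [hsmear]
  refine ⟨htaylor.contDiff, fun n => ⟨0, ‖u‖ * ∫ z, ‖iteratedFDeriv ℝ n k z‖, fun x => ?_⟩⟩
  rw [← htaylor.eq_iteratedFDeriv (mod_cast le_top), pow_zero, mul_one,
    ← integral_sub_left_eq_self (fun z => ‖iteratedFDeriv ℝ n k z‖) volume x, ← integral_const_mul]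
  have hint : Integrable fun z => ‖iteratedFDeriv ℝ n k z‖ := by
    simpa using k.integrable_pow_mul_iteratedFDeriv volume 0 n
  refine norm_integral_le_of_norm_le ((hint.comp_sub_left x).const_mul _) ?_
  filter_upwards [hbound] with y hy
  rw [norm_smul]
  exact mul_le_mul_of_nonneg_right hy (norm_nonneg _)

/-! ### Frequency localization -/

/-- The modulation `x ↦ exp(2πi⟨x, ξ⟩) ψ(x)`, encoded as a translation of the Fourier transform so
that it is a Schwartz function by construction. -/
def modulation (ξ : E) (ψ : 𝓢(E, ℂ)) : 𝓢(E, ℂ) :=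
  𝓕⁻ (SchwartzMap.compSubConstCLM ℂ ξ (𝓕 ψ))

theorem fourier_modulation_apply (ξ : E) (ψ : 𝓢(E, ℂ)) (t : E) :
    𝓕 (modulation ξ ψ) t = 𝓕 ψ (t - ξ) := by
  rw [modulation, FourierTransform.fourier_fourierInv_eq]
  rfl

theorem modulation_apply (ξ : E) (ψ : 𝓢(E, ℂ)) (x : E) :
    modulation ξ ψ x = Real.fourierChar (inner ℝ x ξ) • ψ x := by
  have hψ : ψ x = 𝓕⁻ (𝓕 ψ) x := by rw [FourierTransform.fourierInv_fourier_eq]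
  rw [hψ, modulation, SchwartzMap.fourierInv_coe, SchwartzMap.fourierInv_coe, Real.fourierInv_eq,
    Real.fourierInv_eq, ← integral_add_right_eq_self _ ξ, Circle.smul_def, ← integral_smul]
  refine integral_congr_ae (ae_of_all _ fun t => ?_)
  simp only [SchwartzMap.compSubConstCLM_apply, add_sub_cancel_right, inner_add_left,
    AddChar.map_add_eq_mul, Circle.smul_def, Circle.coe_mul, smul_eq_mul]
  rw [real_inner_comm ξ x]
  ring

theorem fourierInv_smulLeft_smear_apply (K ψ : 𝓢(E, ℂ)) (u : Lp ℂ ⊤ (volume : Measure E))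
    (ξ : E) :
    𝓕⁻ (SchwartzMap.smulLeftCLM ℂ (smear K (Lp.toTemperedDistribution u)) ψ) ξ =
      Lp.toTemperedDistribution u (K ⋆ₛ modulation ξ ψ) := by
  rw [← integral_mul_smear_toTemperedDistribution, SchwartzMap.fourierInv_coe, Real.fourierInv_eq]
  refine integral_congr_ae (ae_of_all _ fun x => ?_)
  dsimp only
  rw [SchwartzMap.smulLeftCLM_apply_apply (hasTemperateGrowth_smear_toTemperedDistribution K u),
    modulation_apply, Circle.smul_def, Circle.smul_def]
  simp only [smul_eq_mul]
  ring

/-- The Fourier transform of `T` is supported in `s`, in the sense that it is annihilated by the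
Schwartz functions that vanish on `s`. -/
def HasSpectrumIn (T : 𝓢'(E, ℂ)) (s : Set E) : Prop :=
  ∀ a : 𝓢(E, ℂ), (∀ η ∈ s, a η = 0) → TemperedDistribution.fourierMultiplierCLM ℂ a T = 0

/-- The Fourier transform of a product is the convolution of the Fourier transforms. -/
theorem hasSpectrumIn_smulLeft_smear_fourierMultiplier (A : 𝓢(E, ℂ))
    (u : Lp ℂ ⊤ (volume : Measure E)) {b : E → ℂ} (hb : b.HasTemperateGrowth) (T : 𝓢'(E, ℂ))
    {s : Set E} (hs : ∀ t ξ, A t ≠ 0 → b ξ ≠ 0 → t + ξ ∈ s) :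
    HasSpectrumIn (TemperedDistribution.smulLeftCLM ℂ
      (smear (𝓕 A) (Lp.toTemperedDistribution u))
      (TemperedDistribution.fourierMultiplierCLM ℂ b T)) s := by
  intro a ha
  ext φ
  have hproduct : SchwartzMap.smulLeftCLM ℂ b (𝓕⁻ (SchwartzMap.smulLeftCLM ℂ
      (smear (𝓕 A) (Lp.toTemperedDistribution u)) (𝓕 a ⋆ₛ φ))) = 0 := by
    ext ξ
    rw [SchwartzMap.smulLeftCLM_apply_apply hb, fourierInv_smulLeft_smear_apply, zero_apply,
      smul_eq_zero, or_iff_not_imp_left]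
    intro hξ
    suffices 𝓕 A ⋆ₛ modulation ξ (𝓕 a ⋆ₛ φ) = 0 by rw [this, map_zero]
    apply (FourierTransform.fourierCLE ℂ 𝓢(E, ℂ)).injective
    ext t
    rw [map_zero, FourierTransform.fourierCLE_apply, fourier_fourier_convolution_apply,
      fourier_modulation_apply, fourier_fourier_convolution_apply, zero_apply, neg_sub,
      mul_eq_zero, or_iff_not_imp_left]
    intro ht
    rw [sub_eq_neg_add, ha _ (hs _ _ ht hξ), zero_mul]
  rw [TemperedDistribution.fourierMultiplierCLM_apply_apply, fourier_smulLeft_fourierInv,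
    TemperedDistribution.smulLeftCLM_apply_apply,
    TemperedDistribution.fourierMultiplierCLM_apply_apply, hproduct, zero_apply,
    ← FourierTransform.fourierCLE_apply (R := ℂ), map_zero, map_zero]

/-- The convolution of a test function with `𝓕 χ` is invisible to `T` and close to the test
function, because `𝓕 χ` has integral `χ 0 = 1`. -/
theorem HasSpectrumIn.norm_apply_le {T : 𝓢'(E, ℂ)} {s : Set E} (hs : HasSpectrumIn T s) {C : ℝ}
    (hC : IsBoundedBy T C) {χ : 𝓢(E, ℂ)} (hχ : ∀ η ∈ s, χ η = 0) (hχ0 : χ 0 = 1)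
    (φ : 𝓢(E, ℂ)) :
    ‖T φ‖ ≤ C * ((∫ w, ‖w‖ * ‖𝓕 χ w‖) * ∫ x, ‖fderiv ℝ φ x‖) := by
  have hlow : T (𝓕 χ ⋆ₛ φ) = 0 := by
    rw [← fourier_smulLeft_fourierInv, ← TemperedDistribution.fourierMultiplierCLM_apply_apply,
      hs χ hχ, zero_apply]
  have hmass : ∫ w, 𝓕 χ w = 1 := by
    have h := schwartz_fourier_fourier_apply χ 0
    rw [neg_zero, hχ0, SchwartzMap.fourier_coe, Real.fourier_eq] at h
    simpa using h
  calc ‖T φ‖ = ‖T (φ - 𝓕 χ ⋆ₛ φ)‖ := by rw [map_sub, hlow, sub_zero]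
    _ ≤ C * ∫ x, ‖(φ - 𝓕 χ ⋆ₛ φ) x‖ := hC.2 _
    _ ≤ _ := mul_le_mul_of_nonneg_left (integral_norm_sub_convolution_le hmass φ) hC.1

/-! ### Dilations -/

/-- The dilation `x ↦ a (t x)` of a Schwartz function. -/
def dilation {V : Type*} [NormedAddCommGroup V] [NormedSpace ℝ V] {t : ℝ} (ht : t ≠ 0)
    (a : 𝓢(V, ℂ)) : 𝓢(V, ℂ) :=
  SchwartzMap.compCLMOfContinuousLinearEquiv ℂ
    (ContinuousLinearEquiv.smulLeft (R₁ := ℝ) (Units.mk0 t ht)) a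

theorem dilation_apply {V : Type*} [NormedAddCommGroup V] [NormedSpace ℝ V] {t : ℝ} (ht : t ≠ 0)
    (a : 𝓢(V, ℂ)) (x : V) : dilation ht a x = a (t • x) :=
  rfl

theorem fourier_dilation_apply {t : ℝ} (ht : t ≠ 0) (a : 𝓢(E, ℂ)) (z : E) :
    𝓕 (dilation ht a) z = |(t ^ Module.finrank ℝ E)⁻¹| • 𝓕 a (t⁻¹ • z) := by
  rw [SchwartzMap.fourier_coe, SchwartzMap.fourier_coe, Real.fourier_eq, Real.fourier_eq,
    ← Measure.integral_comp_smul]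
  simp only [real_inner_smul_left, real_inner_smul_right, inv_mul_cancel_left₀ ht, dilation_apply]

theorem integral_norm_fourier_dilation {t : ℝ} (ht : t ≠ 0) (a : 𝓢(E, ℂ)) :
    ∫ z, ‖𝓕 (dilation ht a) z‖ = ∫ w, ‖𝓕 a w‖ := by
  simp only [fourier_dilation_apply, norm_smul, Real.norm_eq_abs, abs_abs]
  rw [integral_const_mul, Measure.integral_comp_smul volume (fun w => ‖𝓕 a w‖), inv_pow, inv_inv,
    smul_eq_mul, ← mul_assoc, ← abs_mul, inv_mul_cancel₀ (pow_ne_zero _ ht), abs_one, one_mul]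

theorem integral_norm_mul_norm_fourier_dilation {t : ℝ} (ht : t ≠ 0) (a : 𝓢(E, ℂ)) :
    ∫ z, ‖z‖ * ‖𝓕 (dilation ht a) z‖ = |t| * ∫ w, ‖w‖ * ‖𝓕 a w‖ := by
  have hscale (z : E) : ‖z‖ * ‖𝓕 (dilation ht a) z‖ =
      |t| * |(t ^ Module.finrank ℝ E)⁻¹| * (‖t⁻¹ • z‖ * ‖𝓕 a (t⁻¹ • z)‖) := by
    have : |t| ≠ 0 := abs_ne_zero.2 ht
    rw [fourier_dilation_apply, norm_smul, norm_smul, norm_inv, Real.norm_eq_abs, abs_abs,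
      Real.norm_eq_abs]
    field_simp
  simp only [hscale]
  rw [integral_const_mul, Measure.integral_comp_smul volume (fun w => ‖w‖ * ‖𝓕 a w‖), inv_pow,
    inv_inv, smul_eq_mul, mul_assoc, ← mul_assoc |(t ^ _)⁻¹|, ← abs_mul,
    inv_mul_cancel₀ (pow_ne_zero _ ht), abs_one, one_mul]

/-! ### Series of tempered distributions -/

theorem exists_integral_norm_fderiv_le_seminorm :
    ∃ M : ℝ, 0 ≤ M ∧ ∃ s : Finset (ℕ × ℕ), ∀ φ : 𝓢(E, ℂ),
      ∫ x, ‖fderiv ℝ φ x‖ ≤ M * s.sup (schwartzSeminormFamily ℂ E ℂ) φ := by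
  let N := (volume : Measure E).integrablePower
  let I : ℝ := ∫ x : E, (1 + ‖x‖) ^ (-(N : ℝ))
  have hI : 0 ≤ I := integral_nonneg fun x => by positivity
  refine ⟨2 ^ N * I * 2, by positivity, {(0, 1), (N, 1)}, fun φ => ?_⟩
  have hsup {i : ℕ × ℕ} (hi : i ∈ ({(0, 1), (N, 1)} : Finset (ℕ × ℕ))) :
      SchwartzMap.seminorm ℂ i.1 i.2 φ ≤
        ({(0, 1), (N, 1)} : Finset (ℕ × ℕ)).sup (schwartzSeminormFamily ℂ E ℂ) φ :=
    Finset.le_sup (f := schwartzSeminormFamily ℂ E ℂ) hi φ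
  have h := φ.integral_pow_mul_iteratedFDeriv_le ℂ volume 0 1
  simp only [pow_zero, one_mul, norm_iteratedFDeriv_one, zero_add] at h
  refine h.trans ?_
  rw [mul_assoc _ 2]
  gcongr
  linarith [hsup (i := (0, 1)) (by simp), hsup (i := (N, 1)) (by simp)]

theorem summable_of_norm_apply_le_seminorm {V F : Type*} [NormedAddCommGroup V] [NormedSpace ℝ V]
    [NormedAddCommGroup F] [NormedSpace ℂ F] [CompleteSpace F] {κ : Type*}
    {U : κ → 𝓢'(V, F)} {b : κ → ℝ} (hb0 : ∀ j, 0 ≤ b j) (hb : Summable b) (s : Finset (ℕ × ℕ))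
    (hU : ∀ j φ, ‖U j φ‖ ≤ b j * s.sup (schwartzSeminormFamily ℂ V ℂ) φ) : Summable U := by
  have hs (φ) : Summable fun j => U j φ := .of_norm_bounded (hb.mul_right _) fun j => hU j φ
  let S : 𝓢(V, ℂ) →L[ℂ] F := SchwartzMap.mkCLMtoNormedSpace (fun φ => ∑' j, U j φ)
    (fun φ ψ => by simp only [map_add]; exact (hs φ).tsum_add (hs ψ))
    (fun a φ => by simp only [map_smul]; exact (hs φ).tsum_const_smul a)
    ⟨s, ∑' j, b j, tsum_nonneg hb0, fun φ =>
      tsum_of_norm_bounded (hb.hasSum.mul_right _) fun j => hU j φ⟩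
  refine ⟨ContinuousLinearMap.toPointwiseConvergenceCLM ℂ (RingHom.id ℂ) _ _ S,
    PointwiseConvergenceCLM.tendsto_iff_forall_tendsto.2 fun φ => ?_⟩
  exact (hs φ).hasSum.congr fun t =>
    (map_sum (PointwiseConvergenceCLM.evalCLM (RingHom.id ℂ) F φ) U t).symm

end Schwartz

/-! ### Symbols of a dyadic partition -/

namespace DyadicPartition

variable {d : ℕ} (P : DyadicPartition d)

theorem low_zero : P.low 0 = 1 := by
  have hbase : P.base 0 = 0 := by
    by_contra h
    have := (P.base_support (subset_tsupport _ h)).1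
    norm_num at this
  have hsum := P.sum_eq_one 0
  simp only [smul_zero, hbase] at hsum
  linarith [hsum.unique hasSum_zero]

theorem sum_symbol (k : ℕ) (ξ : EuclideanSpace ℝ (Fin d)) :
    ∑ n ∈ Finset.range (k + 1), P.symbol n ξ = P.low ((2 : ℝ)⁻¹ ^ k • ξ) := by
  have htail := (hasSum_nat_add_iff' k).2 (P.sum_eq_one ξ)
  have hscaled := P.sum_eq_one ((2 : ℝ)⁻¹ ^ k • ξ)
  simp only [smul_smul, ← pow_add] at hscaled
  rw [Finset.sum_range_succ']
  simp only [symbol]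
  linarith [hscaled.unique htail]

theorem symbolSchwartz_apply (n : ℕ) (ξ : EuclideanSpace ℝ (Fin d)) :
    P.symbolSchwartz n ξ = P.symbol n ξ := rfl

theorem symbolSchwartz_succ (n : ℕ) : P.symbolSchwartz (n + 1) =
    dilation (t := (2 : ℝ)⁻¹ ^ n) (by positivity) (P.symbolSchwartz 1) := by
  ext ξ
  simp only [dilation_apply, symbolSchwartz_apply, symbol, pow_zero, one_smul]

theorem sum_symbolSchwartz (k : ℕ) : ∑ n ∈ Finset.range (k + 1), P.symbolSchwartz n =
    dilation (t := (2 : ℝ)⁻¹ ^ k) (by positivity) (P.symbolSchwartz 0) := by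
  ext ξ
  rw [dilation_apply, sum_apply]
  simp only [symbolSchwartz_apply]
  exact_mod_cast P.sum_symbol k ξ

theorem norm_lt_of_symbol_ne_zero {n : ℕ} {ξ : EuclideanSpace ℝ (Fin d)} (h : P.symbol n ξ ≠ 0) :
    (2 : ℝ)⁻¹ ^ n * ‖ξ‖ < 4 / 3 := by
  cases n with
  | zero => simpa using P.low_support (subset_tsupport _ h)
  | succ n =>
    have := (P.base_support (subset_tsupport _ h)).2
    rw [norm_smul, Real.norm_of_nonneg (by positivity)] at this
    rw [pow_succ']
    linarith

theorem lt_norm_of_symbol_succ_ne_zero {n : ℕ} {ξ : EuclideanSpace ℝ (Fin d)}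
    (h : P.symbol (n + 1) ξ ≠ 0) : 3 / 4 < (2 : ℝ)⁻¹ ^ n * ‖ξ‖ := by
  have := (P.base_support (subset_tsupport _ h)).1
  rwa [norm_smul, Real.norm_of_nonneg (by positivity)] at this

theorem symbolSchwartz_ne_zero {n : ℕ} {ξ : EuclideanSpace ℝ (Fin d)} :
    P.symbolSchwartz n ξ ≠ 0 ↔ P.symbol n ξ ≠ 0 :=
  Complex.ofReal_ne_zero

theorem exists_integral_norm_fourier_symbolSchwartz_le :
    ∃ L, ∀ n, ∫ z, ‖𝓕 (P.symbolSchwartz n) z‖ ≤ L := by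
  refine ⟨max (∫ z, ‖𝓕 (P.symbolSchwartz 0) z‖) (∫ z, ‖𝓕 (P.symbolSchwartz 1) z‖), fun n => ?_⟩
  cases n with
  | zero => exact le_max_left _ _
  | succ n =>
    rw [symbolSchwartz_succ, integral_norm_fourier_dilation]
    exact le_max_right _ _

/-! ### Terms of the paraproduct -/

theorem sum_blockFun (f : 𝓢'(EuclideanSpace ℝ (Fin d), ℂ)) (k : ℕ) :
    (fun x => ∑ n ∈ Finset.range (k + 1), P.blockFun n f x) =
      smear (𝓕 (dilation (t := (2 : ℝ)⁻¹ ^ k) (by positivity) (P.symbolSchwartz 0))) f := by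
  ext x
  rw [← sum_symbolSchwartz, ← FourierTransform.fourierCLE_apply (R := ℂ), map_sum, smear, map_sum,
    map_sum]
  rfl

theorem hasTemperateGrowth_sum_blockFun
    (u : Lp ℂ ⊤ (volume : Measure (EuclideanSpace ℝ (Fin d)))) (j : ℕ) :
    Function.HasTemperateGrowth fun x =>
      ∑ n ∈ Finset.range j, P.blockFun n (Lp.toTemperedDistribution u) x :=
  .sum fun n _ => hasTemperateGrowth_smear_toTemperedDistribution (𝓕 (P.symbolSchwartz n)) u

theorem paraTerm_zero (f h : 𝓢'(EuclideanSpace ℝ (Fin d), ℂ)) : P.paraTerm f h 0 = 0 := by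
  simp only [paraTerm, Finset.range_zero, Finset.sum_empty,
    TemperedDistribution.smulLeftCLM_const]
  exact zero_smul ℂ (P.block (0 + 1) h)

theorem isBoundedBy_paraTerm (u : Lp ℂ ⊤ (volume : Measure (EuclideanSpace ℝ (Fin d))))
    {h : 𝓢'(EuclideanSpace ℝ (Fin d), ℂ)} {j : ℕ} {C : ℝ}
    (hC : IsBoundedBy (P.block (j + 1) h) C) :
    IsBoundedBy (P.paraTerm (Lp.toTemperedDistribution u) h j)
      (‖u‖ * (∫ z, ‖𝓕 (P.symbolSchwartz 0) z‖) * C) := by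
  refine hC.smulLeft (P.hasTemperateGrowth_sum_blockFun u j) fun x => ?_
  cases j with
  | zero =>
    rw [Finset.range_zero, Finset.sum_empty, norm_zero]
    positivity
  | succ k =>
    rw [congrFun (P.sum_blockFun _ k) x,
      ← integral_norm_fourier_dilation (t := (2 : ℝ)⁻¹ ^ k) (by positivity)]
    exact (isBoundedBy_toTemperedDistribution u).norm_smear_le _ x

/-- The frequencies of the two factors satisfy `2⁻ᵏ |t| < 4/3` and `3/2 < 2⁻ᵏ |ξ| < 16/3`. -/
theorem hasSpectrumIn_paraTerm_succ (u : Lp ℂ ⊤ (volume : Measure (EuclideanSpace ℝ (Fin d))))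
    (h : 𝓢'(EuclideanSpace ℝ (Fin d), ℂ)) (k : ℕ) :
    HasSpectrumIn (P.paraTerm (Lp.toTemperedDistribution u) h (k + 1))
      {η | 1 / 6 < (2 : ℝ)⁻¹ ^ k * ‖η‖ ∧ (2 : ℝ)⁻¹ ^ k * ‖η‖ < 20 / 3} := by
  rw [paraTerm, sum_blockFun]
  refine hasSpectrumIn_smulLeft_smear_fourierMultiplier _ u
    (P.symbolSchwartz (k + 2)).hasTemperateGrowth h fun t ξ ht hξ => ?_
  have hpos : (0 : ℝ) < 2⁻¹ ^ k := by positivity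
  have ht' : (2 : ℝ)⁻¹ ^ k * ‖t‖ < 4 / 3 := by
    rw [dilation_apply] at ht
    have := P.norm_lt_of_symbol_ne_zero (P.symbolSchwartz_ne_zero.1 ht)
    rwa [pow_zero, one_mul, norm_smul, Real.norm_of_nonneg hpos.le] at this
  have hξ_lt := P.norm_lt_of_symbol_ne_zero (P.symbolSchwartz_ne_zero.1 hξ)
  have hξ_gt := P.lt_norm_of_symbol_succ_ne_zero (P.symbolSchwartz_ne_zero.1 hξ)
  rw [pow_succ'] at hξ_gt
  rw [pow_add] at hξ_lt
  have hle := mul_le_mul_of_nonneg_left (norm_add_le t ξ) hpos.le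
  have hge := mul_le_mul_of_nonneg_left (norm_le_add_norm_add ξ t) hpos.le
  rw [add_comm ξ t] at hge
  constructor <;> linarith

theorem block_paraTerm_eq_zero (u : Lp ℂ ⊤ (volume : Measure (EuclideanSpace ℝ (Fin d))))
    (h : 𝓢'(EuclideanSpace ℝ (Fin d), ℂ)) {n k : ℕ} (hnk : n + 3 ≤ k ∨ k + 5 ≤ n) :
    P.block n (P.paraTerm (Lp.toTemperedDistribution u) h (k + 1)) = 0 := by
  refine P.hasSpectrumIn_paraTerm_succ u h k (P.symbolSchwartz n) fun η ⟨hη_gt, hη_lt⟩ => ?_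
  by_contra hne
  have hsymbol := P.symbolSchwartz_ne_zero.1 hne
  have hpow {i j m : ℕ} (hij : i + m ≤ j) :
      (2 : ℝ)⁻¹ ^ j * ‖η‖ ≤ 2⁻¹ ^ m * (2⁻¹ ^ i * ‖η‖) := by
    rw [← mul_assoc, ← pow_add]
    gcongr ?_ * _
    exact pow_le_pow_of_le_one (by norm_num) (by norm_num) (by omega)
  rcases hnk with hnk | hnk
  · linarith [hpow hnk, P.norm_lt_of_symbol_ne_zero hsymbol]
  · obtain ⟨m, rfl⟩ : ∃ m, n = m + 1 := ⟨n - 1, by omega⟩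
    linarith [hpow (m := 4) (show k + 4 ≤ m by omega), P.lt_norm_of_symbol_succ_ne_zero hsymbol]

/-! ### The paraproduct of a bounded function and a distribution with bounded blocks -/

/-- The distributions with uniformly bounded Littlewood-Paley blocks, which form the Besov space
`B⁰_{∞,∞}`. -/
def boundedBlocks : Submodule ℂ 𝓢'(EuclideanSpace ℝ (Fin d), ℂ) where
  carrier := {h | ∃ C, ∀ n, IsBoundedBy (P.block n h) C}
  zero_mem' := ⟨0, fun n => by rw [map_zero]; exact IsBoundedBy.zero⟩
  add_mem' := by
    rintro h h' ⟨C, hC⟩ ⟨C', hC'⟩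
    exact ⟨C + C', fun n => by rw [map_add]; exact (hC n).add (hC' n)⟩
  smul_mem' := by
    rintro c h ⟨C, hC⟩
    exact ⟨‖c‖ * C, fun n => by rw [map_smul]; exact (hC n).smul c⟩

theorem mem_boundedBlocks_of_isBoundedBy {h : 𝓢'(EuclideanSpace ℝ (Fin d), ℂ)} {C : ℝ}
    (hC : IsBoundedBy h C) : h ∈ P.boundedBlocks := by
  obtain ⟨L, hL⟩ := P.exists_integral_norm_fourier_symbolSchwartz_le
  exact ⟨C * L, fun n => (hC.fourierMultiplier (P.symbolSchwartz n)).mono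
    (mul_le_mul_of_nonneg_left (hL n) hC.1)⟩

variable (u : Lp ℂ ⊤ (volume : Measure (EuclideanSpace ℝ (Fin d))))
  {h : 𝓢'(EuclideanSpace ℝ (Fin d), ℂ)}

theorem exists_isBoundedBy_paraTerm (hh : h ∈ P.boundedBlocks) :
    ∃ C, ∀ j, IsBoundedBy (P.paraTerm (Lp.toTemperedDistribution u) h j) C := by
  obtain ⟨C, hC⟩ := hh
  exact ⟨_, fun j => P.isBoundedBy_paraTerm u (hC (j + 1))⟩

theorem paraConverges (hh : h ∈ P.boundedBlocks) :
    P.ParaConverges (Lp.toTemperedDistribution u) h := by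
  obtain ⟨C, hC⟩ := P.exists_isBoundedBy_paraTerm u hh
  obtain ⟨M, hM0, s, hM⟩ :=
    exists_integral_norm_fderiv_le_seminorm (E := EuclideanSpace ℝ (Fin d))
  let I : ℝ := ∫ w, ‖w‖ * ‖𝓕 (P.symbolSchwartz 0) w‖
  have hI : 0 ≤ I := integral_nonneg fun w => by positivity
  have hC0 : 0 ≤ C := (hC 0).1
  refine summable_of_norm_apply_le_seminorm (b := fun j => 16 * C * I * M * (1 / 2) ^ j)
    (fun j => by positivity) (summable_geometric_two.mul_left _) s fun j φ => ?_
  cases j with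
  | zero =>
    rw [paraTerm_zero, zero_apply, norm_zero]
    positivity
  | succ k =>
    have ht : (8 : ℝ) * 2⁻¹ ^ k ≠ 0 := by positivity
    have hχ : ∀ η ∈ {η | 1 / 6 < (2 : ℝ)⁻¹ ^ k * ‖η‖ ∧ (2 : ℝ)⁻¹ ^ k * ‖η‖ < 20 / 3},
        dilation ht (P.symbolSchwartz 0) η = 0 := by
      rintro η ⟨hη, -⟩
      by_contra hne
      rw [dilation_apply] at hne
      have hlow := P.norm_lt_of_symbol_ne_zero (P.symbolSchwartz_ne_zero.1 hne)
      rw [pow_zero, one_mul, norm_smul, Real.norm_of_nonneg (by positivity)] at hlow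
      linarith
    have hχ0 : dilation ht (P.symbolSchwartz 0) 0 = 1 := by
      rw [dilation_apply, smul_zero, symbolSchwartz_apply]
      exact_mod_cast P.low_zero
    have hle := (P.hasSpectrumIn_paraTerm_succ u h k).norm_apply_le (hC _) hχ hχ0 φ
    rw [integral_norm_mul_norm_fourier_dilation, abs_of_pos (by positivity)] at hle
    calc _ ≤ C * (8 * 2⁻¹ ^ k * I * (M * s.sup (schwartzSeminormFamily ℂ _ ℂ) φ)) :=
          hle.trans (by gcongr; exact hM φ)
      _ = _ := by ring

theorem para_mem_boundedBlocks (hh : h ∈ P.boundedBlocks) :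
    P.para (Lp.toTemperedDistribution u) h ∈ P.boundedBlocks := by
  obtain ⟨C, hC⟩ := P.exists_isBoundedBy_paraTerm u hh
  obtain ⟨L, hL⟩ := P.exists_integral_norm_fourier_symbolSchwartz_le
  have hblock (n j : ℕ) :
      IsBoundedBy (P.block n (P.paraTerm (Lp.toTemperedDistribution u) h j)) (C * L) :=
    ((hC j).fourierMultiplier (P.symbolSchwartz n)).mono
      (mul_le_mul_of_nonneg_left (hL n) (hC j).1)
  have hpara (n : ℕ) : P.block n (P.para (Lp.toTemperedDistribution u) h) =
      ∑ j ∈ Finset.Icc (n - 3) (n + 3),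
        P.block n (P.paraTerm (Lp.toTemperedDistribution u) h j) := by
    rw [para, (P.block n).map_tsum (P.paraConverges u hh)]
    refine tsum_eq_sum fun j hj => ?_
    rw [Finset.mem_Icc, not_and_or] at hj
    cases j with
    | zero => rw [paraTerm_zero, map_zero]
    | succ k => exact P.block_paraTerm_eq_zero u h (by omega)
  refine ⟨7 * (C * L), fun n => ?_⟩
  rw [hpara]
  refine (IsBoundedBy.sum _ fun j _ => hblock n j).mono ?_
  rw [Finset.sum_const, nsmul_eq_mul, Nat.card_Icc]
  gcongr
  · exact (hblock 0 0).1
  · exact_mod_cast (by omega : n + 3 + 1 - (n - 3) ≤ 7)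

theorem blockFun_add (n : ℕ) (f f' : 𝓢'(EuclideanSpace ℝ (Fin d), ℂ))
    (x : EuclideanSpace ℝ (Fin d)) :
    P.blockFun n (f + f') x = P.blockFun n f x + P.blockFun n f' x := rfl

theorem blockFun_smul (n : ℕ) (c : ℂ) (f : 𝓢'(EuclideanSpace ℝ (Fin d), ℂ))
    (x : EuclideanSpace ℝ (Fin d)) : P.blockFun n (c • f) x = c * P.blockFun n f x := rfl

theorem paraTerm_add_left (u v : Lp ℂ ⊤ (volume : Measure (EuclideanSpace ℝ (Fin d))))
    (h : 𝓢'(EuclideanSpace ℝ (Fin d), ℂ)) (j : ℕ) :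
    P.paraTerm (Lp.toTemperedDistribution (u + v)) h j =
      P.paraTerm (Lp.toTemperedDistribution u) h j +
        P.paraTerm (Lp.toTemperedDistribution v) h j := by
  have hadd : Lp.toTemperedDistribution (u + v) =
      Lp.toTemperedDistribution u + Lp.toTemperedDistribution v :=
    map_add (Lp.toTemperedDistributionCLM ℂ volume ⊤) u v
  simp only [paraTerm, hadd, blockFun_add, Finset.sum_add_distrib]
  rw [← Pi.add_def, TemperedDistribution.smulLeftCLM_add (P.hasTemperateGrowth_sum_blockFun u j)
    (P.hasTemperateGrowth_sum_blockFun v j), add_apply]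

theorem paraTerm_smul_left (c : ℂ) (u : Lp ℂ ⊤ (volume : Measure (EuclideanSpace ℝ (Fin d))))
    (h : 𝓢'(EuclideanSpace ℝ (Fin d), ℂ)) (j : ℕ) :
    P.paraTerm (Lp.toTemperedDistribution (c • u)) h j =
      c • P.paraTerm (Lp.toTemperedDistribution u) h j := by
  have hsmul : Lp.toTemperedDistribution (c • u) = c • Lp.toTemperedDistribution u :=
    map_smul (Lp.toTemperedDistributionCLM ℂ volume ⊤) c u
  simp only [paraTerm, hsmul, blockFun_smul, ← Finset.mul_sum]
  exact DFunLike.congr_fun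
    (TemperedDistribution.smulLeftCLM_smul (P.hasTemperateGrowth_sum_blockFun u j) c) _

/-- `paraTerm` as a bilinear map. The low frequencies are restricted to bounded functions, since
`smulLeftCLM` is additive only in functions of temperate growth. -/
def paraTermBilin (j : ℕ) : Lp ℂ ⊤ (volume : Measure (EuclideanSpace ℝ (Fin d))) →ₗ[ℂ]
    𝓢'(EuclideanSpace ℝ (Fin d), ℂ) →ₗ[ℂ] 𝓢'(EuclideanSpace ℝ (Fin d), ℂ) :=
  LinearMap.mk₂ ℂ (fun u h => P.paraTerm (Lp.toTemperedDistribution u) h j)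
    (fun u v h => P.paraTerm_add_left u v h j)
    (fun c u h => P.paraTerm_smul_left c u h j)
    (fun u h h' => by simp only [paraTerm, map_add])
    (fun c u h => by simp only [paraTerm, map_smul])

/-- The paraproduct as a bilinear map, on a domain where it converges. -/
def paraBilin : Lp ℂ ⊤ (volume : Measure (EuclideanSpace ℝ (Fin d))) →ₗ[ℂ]
    P.boundedBlocks →ₗ[ℂ] P.boundedBlocks :=
  LinearMap.mk₂ ℂ
    (fun u h => ⟨P.para (Lp.toTemperedDistribution u) h, P.para_mem_boundedBlocks u h.2⟩)
    (fun u v h => Subtype.ext <|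
      (tsum_congr fun j => (P.paraTermBilin j).map_add₂ u v h).trans
        ((P.paraConverges u h.2).tsum_add (P.paraConverges v h.2)))
    (fun c u h => Subtype.ext <|
      (tsum_congr fun j => (P.paraTermBilin j).map_smul₂ c u h).trans
        ((P.paraConverges u h.2).tsum_const_smul c))
    (fun u h h' => Subtype.ext <|
      (tsum_congr fun j => (P.paraTermBilin j u).map_add h h').trans
        ((P.paraConverges u h.2).tsum_add (P.paraConverges u h'.2)))
    (fun c u h => Subtype.ext <|
      (tsum_congr fun j => (P.paraTermBilin j u).map_smul c h).trans
        ((P.paraConverges u h.2).tsum_const_smul c))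

end DyadicPartition

/-! ### Coproducts in homogeneous bases -/

section LeftContraction

variable {R M N : Type*} [CommSemiring R] [AddCommMonoid M] [Module R M] [AddCommMonoid N]
  [Module R N]

/-- The contraction `a ⊗ b ↦ f(a) b` of a tensor with a linear form on its left factor. -/
def leftContraction (f : Module.Dual R M) : M ⊗[R] N →ₗ[R] N :=
  (TensorProduct.lid R N).toLinearMap ∘ₗ f.rTensor N

theorem leftContraction_tmul (f : Module.Dual R M) (a : M) (b : N) :
    leftContraction f (a ⊗ₜ[R] b) = f a • b := rfl

theorem leftContraction_coord {κ : Type*} [DecidableEq κ] (b : Module.Basis κ R M) (k : κ)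
    (z : M ⊗[R] N) :
    leftContraction (b.coord k) z = TensorProduct.equivFinsuppOfBasisLeft b z k := by
  induction z using TensorProduct.induction_on with
  | zero => simp
  | add x y hx hy => rw [map_add, map_add, Finsupp.add_apply, hx, hy]
  | tmul x y => rw [TensorProduct.equivFinsuppOfBasisLeft_apply_tmul_apply]; rfl

theorem leftContraction_lTensor {N' : Type*} [AddCommMonoid N'] [Module R N']
    (f : Module.Dual R M) (L : N →ₗ[R] N') (z : M ⊗[R] N) :
    leftContraction f (L.lTensor M z) = L (leftContraction f z) := by
  induction z using TensorProduct.induction_on with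
  | zero => simp only [map_zero]
  | add x y hx hy => simp only [map_add, hx, hy]
  | tmul x y => simp only [LinearMap.lTensor_tmul, leftContraction_tmul, map_smul]

theorem leftContraction_assoc_tmul {N' : Type*} [AddCommMonoid N'] [Module R N']
    (f : Module.Dual R M) (z : M ⊗[R] N) (c : N') :
    leftContraction f (TensorProduct.assoc R M N N' (z ⊗ₜ[R] c)) =
      leftContraction f z ⊗ₜ[R] c := by
  induction z using TensorProduct.induction_on with
  | zero => simp only [TensorProduct.zero_tmul, map_zero]
  | add x y hx hy => simp only [TensorProduct.add_tmul, map_add, hx, hy]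
  | tmul x y =>
    simp only [TensorProduct.assoc_tmul, leftContraction_tmul, TensorProduct.smul_tmul']

end LeftContraction

theorem leftContraction_mem_of_mem_iSup {ι M N : Type*} [AddCommGroup M] [Module ℝ M]
    [AddCommGroup N] [Module ℝ N] {f : Module.Dual ℝ M} {I : Set ι} {V : ι → Submodule ℝ M}
    {W : ι → Submodule ℝ N} {Q : Submodule ℝ N}
    (hQ : ∀ β ∈ I, (∀ a ∈ V β, f a = 0) ∨ W β ≤ Q) {z : M ⊗[ℝ] N}
    (hz : z ∈ ⨆ β ∈ I, tensorSubmodule (V β) (W β)) : leftContraction f z ∈ Q := by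
  suffices h : ⨆ β ∈ I, tensorSubmodule (V β) (W β) ≤ Q.comap (leftContraction f) from h hz
  refine iSup₂_le fun β hβ => ?_
  rintro _ ⟨w, rfl⟩
  induction w using TensorProduct.induction_on with
  | zero => simp only [map_zero, zero_mem]
  | add x y hx hy => rw [map_add]; exact add_mem hx hy
  | tmul x y =>
    rw [TensorProduct.map_tmul, Submodule.mem_comap, leftContraction_tmul]
    rcases hQ β hβ with hf | hW
    · rw [Submodule.subtype_apply, hf x x.2, zero_smul]
      exact zero_mem Q
    · exact Q.smul_mem _ (hW y.2)

section HomogeneousBasis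

variable {R M κ ι : Type*} [Ring R] [AddCommGroup M] [Module R M] {V : ι → Submodule R M}
  {b : Module.Basis κ R M} {deg : κ → ι} {α : ι} {x : M}

theorem mem_span_homogeneous_basis (hV : iSupIndep V) (hb : ∀ k, b k ∈ V (deg k)) (hx : x ∈ V α) :
    x ∈ Submodule.span R (b '' {k | deg k = α}) := by
  have htop : x ∈ Submodule.span R (b '' {k | deg k = α}) ⊔
      Submodule.span R (b '' {k | deg k = α}ᶜ) := by
    rw [← Submodule.span_union, ← Set.image_union, Set.union_compl_self, Set.image_univ, b.span_eq]
    trivial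
  obtain ⟨s, hs, r, hr, rfl⟩ := Submodule.mem_sup.1 htop
  have hs_mem : s ∈ V α := by
    refine Submodule.span_le.2 ?_ hs
    rintro _ ⟨k, rfl, rfl⟩
    exact hb k
  have hr_mem : r ∈ ⨆ β ≠ α, V β := by
    refine Submodule.span_le.2 ?_ hr
    rintro _ ⟨k, hk, rfl⟩
    exact Submodule.mem_iSup_of_mem _ (Submodule.mem_iSup_of_mem hk (hb k))
  rw [Submodule.disjoint_def.1 (hV α) r (((V α).add_mem_iff_right hs_mem).1 hx) hr_mem, add_zero]
  exact hs

theorem coord_eq_zero_of_deg_ne (hV : iSupIndep V) (hb : ∀ k, b k ∈ V (deg k)) (hx : x ∈ V α)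
    {k : κ} (hk : deg k ≠ α) : b.coord k x = 0 :=
  Finsupp.notMem_support_iff.1 fun hmem =>
    hk (b.repr_support_subset_of_mem_span _ (mem_span_homogeneous_basis hV hb hx) hmem)

end HomogeneousBasis

/-- The reduced coproduct `a ↦ Δa - a ⊗ 1 - 1 ⊗ a` of a bialgebra. -/
def reducedComul (R A : Type*) [CommRing R] [Ring A] [Bialgebra R A] : A →ₗ[R] A ⊗[R] A :=
  Coalgebra.comul - (TensorProduct.mk R A A).flip 1 - TensorProduct.mk R A A 1

theorem reducedComul_apply {R A : Type*} [CommRing R] [Ring A] [Bialgebra R A] (a : A) :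
    reducedComul R A a = Coalgebra.comul (R := R) a - a ⊗ₜ[R] 1 - 1 ⊗ₜ[R] a := rfl

namespace HomogeneousBases

variable {Tp T : Type*} [Ring Tp] [HopfAlgebra ℝ Tp] [AddCommGroup T] [Module ℝ T]
  {S : ConcreteRegularityStructure Tp T} {ιp ι : Type*} (B : HomogeneousBases S ιp ι)

theorem quotP_eq_leftContraction (τ σ : ιp) : B.quotP τ σ =
    leftContraction (B.basisP.coord σ) (Coalgebra.comul (R := ℝ) (B.basisP τ)) := by
  classical
  exact (leftContraction_coord _ _ _).symm

theorem quot_eq_leftContraction (τ σ : ι) : B.quot τ σ =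
    leftContraction (B.basis.coord σ) (S.split (B.basis τ)) := by
  classical
  exact (leftContraction_coord _ _ _).symm

theorem comul_basisP (τ : ιp) : Coalgebra.comul (R := ℝ) (B.basisP τ) =
    ∑ σ ∈ (B.quotP τ).support, B.basisP σ ⊗ₜ[ℝ] B.quotP τ σ := by
  classical
  exact ((TensorProduct.equivFinsuppOfBasisLeft B.basisP).symm_apply_apply _).symm.trans
    (TensorProduct.equivFinsuppOfBasisLeft_symm_apply _ _)

theorem split_basis (τ : ι) :
    S.split (B.basis τ) = ∑ σ ∈ (B.quot τ).support, B.basis σ ⊗ₜ[ℝ] B.quot τ σ := by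
  classical
  exact ((TensorProduct.equivFinsuppOfBasisLeft B.basis).symm_apply_apply _).symm.trans
    (TensorProduct.equivFinsuppOfBasisLeft_symm_apply _ _)

/-! ### The reduced coproduct of the basis elements -/

theorem mem_span_basisP {α : ℝ} {t : Tp} (ht : t ∈ S.gradeP α) :
    t ∈ Submodule.span ℝ (B.basisP '' {τ | B.degP τ = α}) :=
  mem_span_homogeneous_basis S.gradeP_internal.submodule_iSupIndep B.basisP_mem ht

theorem degP_one : B.degP B.one = 0 := by
  by_contra h
  have hmem : B.basisP B.one ∈ S.gradeP 0 := by
    rw [B.basisP_one, S.gradeP_zero]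
    exact Submodule.mem_span_singleton_self _
  have hcoord := B.coord_eq_zero hmem h
  rw [Module.Basis.repr_self, Finsupp.single_eq_same] at hcoord
  exact one_ne_zero hcoord

theorem degP_pos {τ : ιp} (hτ : τ ≠ B.one) : 0 < B.degP τ := by
  refine (S.Ap_nonneg _ (B.degP_mem τ)).lt_of_ne fun hdeg => ?_
  have hmem := B.basisP_mem τ
  rw [← hdeg, S.gradeP_zero, ← B.basisP_one, Submodule.mem_span_singleton] at hmem
  obtain ⟨c, hc⟩ := hmem
  have hcoord := congrArg (B.basisP.coord τ) hc
  simp [Finsupp.single_eq_of_ne hτ] at hcoord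

theorem ne_one_of_degP_pos {τ : ιp} (hτ : 0 < B.degP τ) : τ ≠ B.one := by
  rintro rfl
  exact hτ.ne' B.degP_one

theorem quotP_self {τ : ιp} (hτ : 0 < B.degP τ) : B.quotP τ τ = 1 := by
  have h := leftContraction_mem_of_mem_iSup (f := B.basisP.coord τ) (Q := ⊥)
    (fun β hβ => .inl fun a ha => B.coord_eq_zero ha hβ.2.ne') (S.comul_mem _ hτ _ (B.basisP_mem τ))
  simpa [leftContraction_tmul, ← quotP_eq_leftContraction, ← B.basisP_one,
    Finsupp.single_eq_of_ne (B.ne_one_of_degP_pos hτ), sub_eq_zero] using h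

theorem quotP_one {τ : ιp} (hτ : 0 < B.degP τ) : B.quotP τ B.one = B.basisP τ := by
  have h := leftContraction_mem_of_mem_iSup (f := B.basisP.coord B.one) (Q := ⊥)
    (fun β hβ => .inl fun a ha => B.coord_eq_zero ha (B.degP_one ▸ hβ.1.ne))
    (S.comul_mem _ hτ _ (B.basisP_mem τ))
  simpa [leftContraction_tmul, ← quotP_eq_leftContraction, ← B.basisP_one,
    Finsupp.single_eq_of_ne (B.ne_one_of_degP_pos hτ).symm, sub_eq_zero] using h

theorem one_ltP {τ : ιp} (hτ : τ ≠ B.one) : B.ltP B.one τ := by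
  refine ⟨?_, hτ.symm⟩
  rw [B.quotP_one (B.degP_pos hτ)]
  exact B.basisP.ne_zero τ

theorem support_quotP [DecidableEq ιp] {τ : ιp} (hτ : 0 < B.degP τ) :
    (B.quotP τ).support = insert τ (insert B.one (B.betweenP B.one τ)) := by
  ext ν
  simp only [Finset.mem_insert, mem_betweenP, Finsupp.mem_support_iff]
  constructor
  · intro hν
    by_cases hντ : ν = τ
    · exact .inl hντ
    by_cases hν1 : ν = B.one
    · exact .inr (.inl hν1)
    exact .inr (.inr ⟨B.one_ltP hν1, hν, hντ⟩)
  · rintro (rfl | rfl | hν)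
    · rw [B.quotP_self hτ, ← B.basisP_one]
      exact B.basisP.ne_zero _
    · rw [B.quotP_one hτ]
      exact B.basisP.ne_zero _
    · exact hν.2.1

theorem reducedComul_basisP {τ : ιp} (hτ : 0 < B.degP τ) : reducedComul ℝ Tp (B.basisP τ) =
    ∑ ν ∈ B.betweenP B.one τ, B.basisP ν ⊗ₜ[ℝ] B.quotP τ ν := by
  classical
  have hone : B.one ∉ B.betweenP B.one τ := fun h => ((B.mem_betweenP ..).1 h).1.2 rfl
  have hself : τ ∉ insert B.one (B.betweenP B.one τ) := by
    rw [Finset.mem_insert, mem_betweenP, not_or]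
    exact ⟨B.ne_one_of_degP_pos hτ, fun h => h.2.2 rfl⟩
  rw [reducedComul_apply, B.comul_basisP, B.support_quotP hτ, Finset.sum_insert hself,
    Finset.sum_insert hone, B.quotP_self hτ, B.quotP_one hτ, B.basisP_one]
  abel

/-! ### The reduced coproduct of `τ / σ` -/

theorem coord_basis_eq_zero {β : ℝ} {t : T} (ht : t ∈ S.grade β) {σ : ι} (hσ : B.deg σ ≠ β) :
    B.basis.coord σ t = 0 :=
  coord_eq_zero_of_deg_ne S.grade_internal.submodule_iSupIndep B.basis_mem ht hσ

theorem quot_self (τ : ι) : B.quot τ τ = 1 := by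
  have h := leftContraction_mem_of_mem_iSup (f := B.basis.coord τ) (Q := ⊥)
    (fun β hβ => .inl fun a ha => B.coord_basis_eq_zero ha (Set.mem_Iio.1 hβ).ne')
    (S.split_mem _ _ (B.basis_mem τ))
  simpa [leftContraction_tmul, ← quot_eq_leftContraction, sub_eq_zero] using h

theorem quot_mem_gradeP {σ τ : ι} (hστ : σ ≠ τ) :
    B.quot τ σ ∈ S.gradeP (B.deg τ - B.deg σ) := by
  have h := leftContraction_mem_of_mem_iSup (f := B.basis.coord σ)
    (Q := S.gradeP (B.deg τ - B.deg σ)) (fun β _ => ?_) (S.split_mem _ _ (B.basis_mem τ))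
  · simpa [leftContraction_tmul, ← quot_eq_leftContraction, Finsupp.single_eq_of_ne hστ] using h
  · by_cases hβ : B.deg σ = β
    · exact .inr (hβ ▸ le_rfl)
    · exact .inl fun a ha => B.coord_basis_eq_zero ha hβ

theorem deg_lt {σ τ : ι} (hστ : B.lt σ τ) : B.deg σ < B.deg τ := by
  by_contra hdeg
  have h := leftContraction_mem_of_mem_iSup (f := B.basis.coord σ) (Q := ⊥)
    (fun β hβ => .inl fun a ha => B.coord_basis_eq_zero ha fun e => hdeg (e ▸ Set.mem_Iio.1 hβ))
    (S.split_mem _ _ (B.basis_mem τ))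
  exact hστ.1 (by simpa [leftContraction_tmul, ← quot_eq_leftContraction,
    Finsupp.single_eq_of_ne hστ.2] using h)

/-- The left contraction of the comodule identity at `τ` with the coordinate along `σ`. -/
theorem comul_quot (σ τ : ι) : Coalgebra.comul (R := ℝ) (B.quot τ σ) =
    ∑ η ∈ (B.quot τ).support, B.quot η σ ⊗ₜ[ℝ] B.quot τ η := by
  have hcomodule := congrArg (leftContraction (B.basis.coord σ))
    (LinearMap.congr_fun S.split_comodule (B.basis τ))
  simp only [LinearMap.comp_apply, leftContraction_lTensor, ← quot_eq_leftContraction]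
    at hcomodule
  rw [← hcomodule, B.split_basis τ]
  simp only [map_sum, LinearMap.rTensor_tmul, LinearEquiv.coe_coe, leftContraction_assoc_tmul,
    ← quot_eq_leftContraction]

theorem sum_support_quot {σ τ : ι} (hστ : B.lt σ τ) :
    ∑ η ∈ (B.quot τ).support, B.quot η σ ⊗ₜ[ℝ] B.quot τ η =
      B.quot τ σ ⊗ₜ[ℝ] 1 + (1 ⊗ₜ[ℝ] B.quot τ σ +
        ∑ η ∈ B.between σ τ, B.quot η σ ⊗ₜ[ℝ] B.quot τ η) := by
  classical
  have hσ : σ ∉ B.between σ τ := fun h => ((B.mem_between ..).1 h).1.2 rfl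
  have hτ : τ ∉ insert σ (B.between σ τ) := by
    rw [Finset.mem_insert, mem_between, not_or]
    exact ⟨hστ.2.symm, fun h => h.2.2 rfl⟩
  trans ∑ η ∈ insert τ (insert σ (B.between σ τ)), B.quot η σ ⊗ₜ[ℝ] B.quot τ η
  · refine Finset.sum_congr_of_eq_on_inter (fun η hη hη' => ?_) (fun η _ hη' => ?_)
      fun _ _ _ => rfl
    · rw [Finset.mem_insert, Finset.mem_insert, mem_between, not_or, not_or] at hη'
      have hησ : B.quot η σ = 0 := by
        by_contra hne
        exact hη'.2.2 ⟨⟨hne, Ne.symm hη'.2.1⟩, Finsupp.mem_support_iff.1 hη, hη'.1⟩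
      rw [hησ, TensorProduct.zero_tmul]
    · rw [Finsupp.notMem_support_iff.1 hη', TensorProduct.tmul_zero]
  · rw [Finset.sum_insert hτ, Finset.sum_insert hσ, B.quot_self, B.quot_self]

theorem reducedComul_quot {σ τ : ι} (hστ : B.lt σ τ) : reducedComul ℝ Tp (B.quot τ σ) =
    ∑ η ∈ B.between σ τ, B.quot η σ ⊗ₜ[ℝ] B.quot τ η := by
  rw [reducedComul_apply, B.comul_quot, B.sum_support_quot hστ]
  abel

end HomogeneousBases

/-! ### Brackets and the reduced coproduct -/

section Brackets

variable {d : ℕ} {Tp T : Type*} [Ring Tp] [HopfAlgebra ℝ Tp] [AddCommGroup T] [Module ℝ T]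
  {S : ConcreteRegularityStructure Tp T} {ιp ι : Type*} (B : HomogeneousBases S ιp ι)
  (P : DyadicPartition d) {g : EuclideanSpace ℝ (Fin d) → Tp →ₐ[ℝ] ℝ}

theorem funDistribution_eq_toTemperedDistribution {f : EuclideanSpace ℝ (Fin d) → ℝ}
    (hf : MemLp (fun x => (f x : ℂ)) ⊤ volume) :
    funDistribution f = Lp.toTemperedDistribution (hf.toLp _) :=
  dif_pos hf

theorem memLp_of_memLp_basis {κ : Type*} (b : Module.Basis κ ℝ Tp)
    (hg : ∀ k, MemLp (fun x => (g x (b k) : ℂ)) ⊤ volume) (a : Tp) :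
    MemLp (fun x => (g x a : ℂ)) ⊤ volume := by
  rw [← b.linearCombination_repr a]
  simp only [Finsupp.linearCombination_apply, Finsupp.sum, map_sum, map_smul, smul_eq_mul,
    Complex.ofReal_sum, Complex.ofReal_mul]
  exact memLp_finsetSum _ fun k _ => (hg k).const_mul _

variable (hg : ∀ a, MemLp (fun x => (g x a : ℂ)) ⊤ volume)

/-- The linear map `a ↦ g(a)` with values in `L^∞`. -/
def characterLp : Tp →ₗ[ℝ] Lp ℂ ⊤ (volume : Measure (EuclideanSpace ℝ (Fin d))) where
  toFun a := (hg a).toLp _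
  map_add' a b := by
    rw [← MemLp.toLp_add]
    congr 1
    ext x
    simp
  map_smul' c a := by
    rw [RingHom.id_apply, ← MemLp.toLp_const_smul]
    congr 1
    ext x
    simp

theorem funDistribution_eq_characterLp (a : Tp) :
    funDistribution (fun x => g x a) = Lp.toTemperedDistribution (characterLp hg a) :=
  funDistribution_eq_toTemperedDistribution (hg a)

include hg in
theorem bracketBasis_mem_boundedBlocks (τ : ιp) : bracketBasis B P g τ ∈ P.boundedBlocks := by
  induction hn : B.rankP τ using Nat.strong_induction_on generalizing τ with
  | _ n ih =>
    rw [eq_sub_iff_add_eq'.2 (bracketBasis_spec B P g τ).symm]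
    refine sub_mem ?_ (sum_mem fun ν hν => ?_)
    · rw [funDistribution_eq_characterLp hg]
      exact P.mem_boundedBlocks_of_isBoundedBy (isBoundedBy_toTemperedDistribution _)
    · rw [funDistribution_eq_characterLp hg]
      exact P.para_mem_boundedBlocks _ (ih _ (hn ▸ B.rankP_lt hν) ν rfl)

include hg in
theorem bracket_mem_boundedBlocks (a : Tp) : bracket B P g a ∈ P.boundedBlocks := by
  rw [bracket, Module.Basis.constr_apply]
  exact sum_mem fun τ _ =>
    P.boundedBlocks.smul_of_tower_mem _ (bracketBasis_mem_boundedBlocks B P hg τ)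

include hg in
theorem paraConverges_bracketBasis (a : Tp) (ν : ιp) :
    P.ParaConverges (funDistribution fun x => g x a) (bracketBasis B P g ν) := by
  rw [funDistribution_eq_characterLp hg]
  exact P.paraConverges _ (bracketBasis_mem_boundedBlocks B P hg ν)

include hg in
theorem paraConverges_bracket (a b : Tp) :
    P.ParaConverges (funDistribution fun x => g x a) (bracket B P g b) := by
  rw [funDistribution_eq_characterLp hg]
  exact P.paraConverges _ (bracket_mem_boundedBlocks B P hg b)

/-- The bracket `⟦·⟧^g` with values in the domain of the paraproduct. -/
def bracketBlocks : Tp →ₗ[ℝ] P.boundedBlocks where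
  toFun a := ⟨bracket B P g a, bracket_mem_boundedBlocks B P hg a⟩
  map_add' a b := Subtype.ext (map_add (bracket B P g) a b)
  map_smul' c a := Subtype.ext (map_smul (bracket B P g) c a)

/-- The linear map `a ⊗ b ↦ P_{g(b)} ⟦a⟧^g`. -/
def paraTensor : Tp ⊗[ℝ] Tp →ₗ[ℝ] 𝓢'(EuclideanSpace ℝ (Fin d), ℂ) :=
  P.boundedBlocks.subtype.restrictScalars ℝ ∘ₗ TensorProduct.lift
    ((P.paraBilin.restrictScalars₁₂ ℝ ℝ).compl₁₂ (characterLp hg) (bracketBlocks B P hg)).flip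

theorem paraTensor_tmul (a b : Tp) : paraTensor B P hg (a ⊗ₜ[ℝ] b) =
    P.para (funDistribution fun x => g x b) (bracket B P g a) := by
  rw [funDistribution_eq_characterLp hg]
  rfl

theorem bracket_basisP (τ : ιp) : bracket B P g (B.basisP τ) = bracketBasis B P g τ :=
  B.basisP.constr_basis ℝ _ τ

theorem funDistribution_eq_paraTensor_reducedComul_add_bracket {α : ℝ} (hα : 0 < α) {t : Tp}
    (ht : t ∈ S.gradeP α) : funDistribution (fun x => g x t) =
      paraTensor B P hg (reducedComul ℝ Tp t) + bracket B P g t := by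
  let toDistribution : Tp →ₗ[ℝ] 𝓢'(EuclideanSpace ℝ (Fin d), ℂ) :=
    (Lp.toTemperedDistributionCLM ℂ volume ⊤).toLinearMap.restrictScalars ℝ ∘ₗ characterLp hg
  have hdist (a : Tp) : toDistribution a = funDistribution fun x => g x a :=
    (funDistribution_eq_characterLp hg a).symm
  let expansion : Tp →ₗ[ℝ] 𝓢'(EuclideanSpace ℝ (Fin d), ℂ) :=
    paraTensor B P hg ∘ₗ reducedComul ℝ Tp + bracket B P g
  suffices h : Set.EqOn toDistribution expansion (B.basisP '' {τ | B.degP τ = α}) from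
    (hdist t).symm.trans (LinearMap.eqOn_span h (B.mem_span_basisP ht))
  rintro _ ⟨τ, rfl, rfl⟩
  rw [hdist, LinearMap.add_apply, LinearMap.comp_apply, bracketBasis_spec B P,
    B.reducedComul_basisP hα, map_sum]
  simp only [paraTensor_tmul, bracket_basisP]

include hg in
theorem funDistribution_quot {σ τ : ι} (hστ : B.lt σ τ) :
    funDistribution (fun x => g x (B.quot τ σ)) =
      (∑ η ∈ B.between σ τ,
        P.para (funDistribution (fun x => g x (B.quot τ η))) (bracket B P g (B.quot η σ))) +
      bracket B P g (B.quot τ σ) := by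
  rw [funDistribution_eq_paraTensor_reducedComul_add_bracket B P hg (sub_pos.2 (B.deg_lt hστ))
    (B.quot_mem_gradeP hστ.2), B.reducedComul_quot hστ, map_sum]
  simp only [paraTensor_tmul]

end Brackets

/-! ### Continuity of the characters -/

theorem charIncrement_convMul {X Tp : Type*} [Ring Tp] [HopfAlgebra ℝ Tp]
    (g : X → Tp →ₐ[ℝ] ℝ) (y x : X) :
    WithConv.toConv (charIncrement g y x) * WithConv.toConv (g x).toLinearMap =
      WithConv.toConv (g y).toLinearMap := by
  have hinv : WithConv.toConv ((g x).toLinearMap ∘ₗ HopfAlgebra.antipode ℝ) *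
      WithConv.toConv (g x).toLinearMap = 1 := by
    have hcomp := LinearMap.algHom_comp_convMul_distrib (g x)
      (WithConv.toConv (HopfAlgebra.antipode ℝ (A := Tp)))
      (WithConv.toConv (LinearMap.id : Tp →ₗ[ℝ] Tp))
    rw [LinearMap.antipode_mul_id, LinearMap.algHom_comp_convOne] at hcomp
    exact congrArg WithConv.toConv hcomp.symm
  have hdef : WithConv.toConv (charIncrement g y x) = WithConv.toConv (g y).toLinearMap *
      WithConv.toConv ((g x).toLinearMap ∘ₗ HopfAlgebra.antipode ℝ) := rfl
  rw [hdef, mul_assoc, hinv, mul_one]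

theorem charIncrement_one {X Tp : Type*} [Ring Tp] [HopfAlgebra ℝ Tp]
    (g : X → Tp →ₐ[ℝ] ℝ) (y x : X) : charIncrement g y x 1 = 1 := by
  simp [charIncrement, Algebra.TensorProduct.one_def]

theorem HomogeneousBases.apply_basisP_eq_sum_charIncrement {X Tp T ιp ι : Type*} [Ring Tp]
    [HopfAlgebra ℝ Tp] [AddCommGroup T] [Module ℝ T] {S : ConcreteRegularityStructure Tp T}
    (B : HomogeneousBases S ιp ι) (g : X → Tp →ₐ[ℝ] ℝ) (y x : X) (τ : ιp) :
    g y (B.basisP τ) = ∑ σ ∈ (B.quotP τ).support,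
      charIncrement g y x (B.basisP σ) * g x (B.quotP τ σ) := by
  have hconv := congrArg (fun f : WithConv (Tp →ₗ[ℝ] ℝ) => f.ofConv (B.basisP τ))
    (charIncrement_convMul g y x)
  refine hconv.symm.trans ?_
  rw [LinearMap.convMul_apply, B.comul_basisP]
  simp

namespace IsModelMap

variable {d : ℕ} {Tp T : Type*} [Ring Tp] [HopfAlgebra ℝ Tp] [AddCommGroup T] [Module ℝ T]
  {S : ConcreteRegularityStructure Tp T} {ιp ι : Type*} {B : HomogeneousBases S ιp ι}
  {g : EuclideanSpace ℝ (Fin d) → Tp →ₐ[ℝ] ℝ}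

theorem continuousAt_charIncrement (hg : IsModelMap B g) (x : EuclideanSpace ℝ (Fin d))
    (σ : ιp) : ContinuousAt (fun y => charIncrement g y x (B.basisP σ)) x := by
  by_cases hσ : σ = B.one
  · simp only [hσ, B.basisP_one, charIncrement_one]
    exact continuousAt_const
  have hpos := B.degP_pos hσ
  obtain ⟨C, -, hC⟩ := hg σ
  have hlim : Filter.Tendsto (fun y => C * ‖y - x‖ ^ B.degP σ) (nhds x) (nhds 0) := by
    have hcont : ContinuousAt (fun y => C * ‖y - x‖ ^ B.degP σ) x :=
      continuousAt_const.mul ((by fun_prop : ContinuousAt (fun y => ‖y - x‖) x).rpow_const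
        (Or.inr hpos.le))
    simpa [hpos.ne'] using hcont.tendsto
  have hzero : charIncrement g x x (B.basisP σ) = 0 := by
    simpa [hpos.ne'] using hC x x
  rw [ContinuousAt, hzero]
  exact squeeze_zero_norm (fun y => hC x y) hlim

theorem continuous_basisP (hg : IsModelMap B g) (τ : ιp) :
    Continuous fun x => g x (B.basisP τ) := by
  refine continuous_iff_continuousAt.2 fun x => ?_
  rw [funext fun y => B.apply_basisP_eq_sum_charIncrement g y x τ]
  exact tendsto_finsetSum _ fun σ _ => (hg.continuousAt_charIncrement x σ).mul_const _

theorem memLp_basisP (hg : IsModelMap B g) (τ : ιp) :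
    MemLp (fun x => (g x (B.basisP τ) : ℂ)) ⊤ volume := by
  obtain ⟨C, hC, -⟩ := hg τ
  exact memLp_top_of_bound
    (Complex.continuous_ofReal.comp (hg.continuous_basisP τ)).aestronglyMeasurable C
    (ae_of_all _ fun x => by simpa using hC x)

end IsModelMap

theorem mainTheorem6_general {d : ℕ} {Tp T : Type*} [Ring Tp] [HopfAlgebra ℝ Tp]
    [AddCommGroup T] [Module ℝ T] {S : ConcreteRegularityStructure Tp T}
    {ιp ι : Type*} (B : HomogeneousBases S ιp ι) (P : DyadicPartition d)
    {g : EuclideanSpace ℝ (Fin d) → Tp →ₐ[ℝ] ℝ}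
    (hg : ∀ τ, MemLp (fun x => (g x (B.basisP τ) : ℂ)) ⊤ volume) :
    (∀ ν τ : ιp, ν ∈ B.betweenP B.one τ →
      P.ParaConverges (funDistribution (fun x => g x (B.quotP τ ν))) (bracketBasis B P g ν)) ∧
    ∀ σ τ : ι, B.lt σ τ →
      (∀ η ∈ B.between σ τ,
        P.ParaConverges (funDistribution (fun x => g x (B.quot τ η)))
          (bracket B P g (B.quot η σ))) ∧
      funDistribution (fun x => g x (B.quot τ σ)) =
        (∑ η ∈ B.between σ τ,
          P.para (funDistribution (fun x => g x (B.quot τ η))) (bracket B P g (B.quot η σ))) +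
        bracket B P g (B.quot τ σ) := by
  have hg' := memLp_of_memLp_basis B.basisP hg
  exact ⟨fun ν τ _ => paraConverges_bracketBasis B P hg' (B.quotP τ ν) ν,
    fun σ τ hστ => ⟨fun η _ => paraConverges_bracket B P hg' (B.quot τ η) (B.quot η σ),
      funDistribution_quot B P hg' hστ⟩⟩

end

theorem mainTheorem6 {d : ℕ} {Tp T : Type*} [Ring Tp] [HopfAlgebra ℝ Tp]
    [AddCommGroup T] [Module ℝ T] (S : ConcreteRegularityStructure Tp T)
    {ιp ι : Type*} (B : HomogeneousBases S ιp ι) (P : DyadicPartition d)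
    (g : EuclideanSpace ℝ (Fin d) → Tp →ₐ[ℝ] ℝ) (hg : IsModelMap B g) :
    (∀ ν τ : ιp, ν ∈ B.betweenP B.one τ →
      P.ParaConverges (funDistribution (fun x => g x (B.quotP τ ν))) (bracketBasis B P g ν)) ∧
    ∀ σ τ : ι, B.lt σ τ →
      (∀ η ∈ B.between σ τ,
        P.ParaConverges (funDistribution (fun x => g x (B.quot τ η)))
          (bracket B P g (B.quot η σ))) ∧
      funDistribution (fun x => g x (B.quot τ σ)) =
        (∑ η ∈ B.between σ τ,
          P.para (funDistribution (fun x => g x (B.quot τ η))) (bracket B P g (B.quot η σ))) +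
        bracket B P g (B.quot τ σ) :=
  mainTheorem6_general B P hg.memLp_basisP
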